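/- Let $(\Omega,\mathcal F,P)$ be a probability space and let $(X_t)_{t\ge 0}$ be a real-valued process with right-continuous paths having left limits; put $\mathcal G_\infty=\sigma(X_s: s\ge 0)$. Let $K\ge 1$ and, for $i\ne j$ in $\{1,\dots,K\}$, let $\lambda_{i,j}:\mathbb R\to[0,\infty)$ be bounded and continuous; put $\lambda_i(x)=\sum_{k\ne i}\lambda_{i,k}(x)$, and let $A_X(s)$ be the $K\times K$ matrix with off-diagonal entries $\lambda_{i,j}(X_s)$ and diagonal entries $-\lambda_i(X_s)$. For $0\le s\le t$ let $P_X(s,t)$ be the transition matrix generated by $A_X$, i.e. the (pathwise unique) solution of Kolmogorov's backward equation $P_X(s,t)=I+\int_s^t A_X(u)P_X(u,t)\,du$, given by the time-ordered exponential of $A_X$ on $[s,t]$. Let $(S_t)_{t\ge 0}$ be a process with right-continuous paths in $\{1,\dots,K\}$ which is a continuous-time Markov chain with stochastic transition rates $\lambda_{i,j}(X_s)$: conditionally on the whole path of $X$ it is a Markov chain with transition matrices $P_X(s,t)$, that is, for all $0\le s\le t$ and all $j$, $$P\big(S_t=j \mid \mathcal G_\infty\vee\sigma(S_u:u\le s)\big)=P_X(s,t)_{S_s,j}\quad\text{a.s.}$$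 State $K$ is the default state, and the initial state $S_0$ is a (deterministic) state in $\{1,\dots,K-1\}$. Let $N>0$, $N_i=iN$ for $i=0,1,2,\dots$, and define (with $\inf\emptyset=\infty$) $$\tau_r=\inf\{N_i: S_{N_i}=K\},\qquad \tau_e=\sup\{t\le\tau_r: S_t\ne K\}.$$ Let $P^*_X(s,t)$ be the $(K-1)\times K$ matrix obtained from $P_X(s,t)$ by deleting the $K$th row, and $P^{**}_X(s,t)$ the $(K-1)\times(K-1)$ matrix obtained by deleting the $K$th row and the $K$th column. Products of matrices are ordered, $\prod_{j=0}^{i-1}M_j=M_0M_1\cdots M_{i-1}$, and the empty product is the identity. Then for every integer $i\ge 0$ and every $t\in[0,N]$, almost surely, $$P(\tau_e\in(N_i,N_i+t]\mid\mathcal G_\infty)=\Big(\prod_{j=0}^{i-1}P^{**}_X(N_j,N_{j+1})\cdot P^*_X(N_i,N_i+t)\Big)_{S_0,K}\exp\Big\{-\int_{N_i+t}^{N_{i+1}}\lambda_K(X_u)\,du\Big\},$$ $$P(\tau_r=N_{i+1}\mid\mathcal G_\infty)=\Big(\prod_{j=0}^{i-1}P^{**}_X(N_j,N_{j+1})\cdot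 P^*_X(N_i,N_{i+1})\Big)_{S_0,K},$$ $$P(\tau_r<\infty,\ \tau_r-\tau_e>t\mid\mathcal G_\infty)=\sum_{i=0}^{\infty}\Big(\prod_{j=0}^{i-1}P^{**}_X(N_j,N_{j+1})\cdot P^*_X(N_i,N_{i+1}-t)\Big)_{S_0,K}\exp\Big\{-\int_{N_{i+1}-t}^{N_{i+1}}\lambda_K(X_u)\,du\Big\},$$ where the series converges almost surely. -/

import Mathlib

open MeasureTheory ProbabilityTheory Filter Topology
open scoped NNReal ENNReal BoundedContinuousFunction

namespace CommonFactorChain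

section TransitionMatrix

theorem mul_entry_bound {κ : Type*} [Fintype κ] {A : ℝ → Matrix κ κ ℝ} {C : ℝ} (hC0 : 0 ≤ C)
    (hC : ∀ u i j, |A u i j| ≤ C) {B : ℝ} {Q : Matrix κ κ ℝ} (hQ : ∀ i j, |Q i j| ≤ B)
    (u : ℝ) (i j : κ) : |(A u * Q) i j| ≤ Fintype.card κ * C * B := by
  rw [Matrix.mul_apply]
  calc |∑ l, A u i l * Q l j| ≤ ∑ l, |A u i l * Q l j| := Finset.abs_sum_le_sum_abs _ _
    _ ≤ ∑ _l : κ, C * B := by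
        refine Finset.sum_le_sum fun l _ => ?_
        rw [abs_mul]
        exact mul_le_mul (hC _ _ _) (hQ _ _) (abs_nonneg _) hC0
    _ = Fintype.card κ * C * B := by simp [mul_assoc]

variable {ι : Type*} [Fintype ι] [DecidableEq ι]

/-- The `k`-th term of the time-ordered exponential of `A` on `[s, t]`, i.e. the iterated integral
`∫_{s ≤ u₁ ≤ ⋯ ≤ u_k ≤ t} A(u₁) ⋯ A(u_k)`. -/
noncomputable def orderedTerm (A : ℝ → Matrix ι ι ℝ) : ℕ → ℝ → ℝ → Matrix ι ι ℝ
  | 0, _, _ => 1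
  | k + 1, s, t => Matrix.of fun i j => ∫ u in s..t, (A u * orderedTerm A k u t) i j

/-- The transition matrix `P(s, t)` generated by the time-dependent rate matrix `A`: the
time-ordered exponential of `A` on `[s, t]`. It solves Kolmogorov's backward equation
`∂P(s, t)/∂s = -A(s) P(s, t)`, `P(t, t) = I`; see `transitionMatrix_backward`. -/
noncomputable def transitionMatrix (A : ℝ → Matrix ι ι ℝ) (s t : ℝ) : Matrix ι ι ℝ :=
  Matrix.of fun i j => ∑' k : ℕ, orderedTerm A k s t i j

theorem orderedTerm_continuous {A : ℝ → Matrix ι ι ℝ} {C : ℝ}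
    (hm : ∀ i j, Measurable fun u => A u i j) (hC : ∀ u i j, |A u i j| ≤ C) (t : ℝ) (k : ℕ)
    (i j : ι) : Continuous fun u => orderedTerm A k u t i j := by
  induction k generalizing i j with
  | zero => simpa only [orderedTerm] using continuous_const
  | succ k ih =>
    have hint : ∀ a b : ℝ, IntervalIntegrable
        (fun u => (A u * orderedTerm A k u t) i j) volume a b := by
      intro a b
      simp only [Matrix.mul_apply]
      have h : IntervalIntegrable (∑ l : ι, fun u => A u i l * orderedTerm A k u t l j)
          volume a b := by
        refine IntervalIntegrable.sum _ fun l _ => ?_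
        refine IntervalIntegrable.mul_continuousOn ?_ (ih l j).continuousOn
        refine (intervalIntegrable_const (c := C)).mono_fun (hm i l).aestronglyMeasurable ?_
        refine Eventually.of_forall fun u => ?_
        simpa only [Real.norm_eq_abs] using (hC u i l).trans (le_abs_self C)
      convert h using 1
      ext u
      simp
    have h := (intervalIntegral.continuous_primitive hint t).neg
    convert h using 1
    ext u
    simp only [orderedTerm, Matrix.of_apply]
    exact intervalIntegral.integral_symm _ _

theorem orderedTerm_bound {A : ℝ → Matrix ι ι ℝ} {C : ℝ} (hC0 : 0 ≤ C)
    (hC : ∀ u i j, |A u i j| ≤ C) (t : ℝ) (k : ℕ) (s : ℝ) (hst : s ≤ t) (i j : ι) :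
    |orderedTerm A k s t i j| ≤
      (Fintype.card ι * C) ^ k * ((t - s) ^ k / (k.factorial : ℝ)) := by
  induction k generalizing s i j with
  | zero =>
    simp only [orderedTerm, Matrix.one_apply]
    split_ifs <;> simp
  | succ k ih =>
    set M : ℝ := Fintype.card ι * C with hM
    simp only [orderedTerm, Matrix.of_apply]
    have h1 : |∫ u in s..t, (A u * orderedTerm A k u t) i j| ≤
        ∫ u in s..t, M * (M ^ k * ((t - u) ^ k / (k.factorial : ℝ))) := by
      rw [← Real.norm_eq_abs]
      refine intervalIntegral.norm_integral_le_of_norm_le hst ?_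
        (Continuous.intervalIntegrable (by fun_prop) _ _)
      refine Eventually.of_forall fun u hu => ?_
      exact mul_entry_bound hC0 hC (fun i j => ih u hu.2 i j) u i j
    refine h1.trans (le_of_eq ?_)
    have h2 : ∫ u in s..t, (t - u) ^ k = (t - s) ^ (k + 1) / (k + 1) := by
      rw [intervalIntegral.integral_comp_sub_left (fun x => x ^ k) t]
      simp
    simp only [intervalIntegral.integral_const_mul, intervalIntegral.integral_div, h2]
    rw [Nat.factorial_succ]
    push_cast
    field_simp
    ring

/-- Kolmogorov's backward equation in integral form. -/
theorem transitionMatrix_backward {A : ℝ → Matrix ι ι ℝ} {C : ℝ}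
    (hm : ∀ i j, Measurable fun u => A u i j) (hC : ∀ u i j, |A u i j| ≤ C)
    {s t : ℝ} (hst : s ≤ t) (i j : ι) :
    transitionMatrix A s t i j =
      (1 : Matrix ι ι ℝ) i j + ∫ u in s..t, (A u * transitionMatrix A u t) i j := by
  have hC0 : 0 ≤ C := (abs_nonneg _).trans (hC s i j)
  set M : ℝ := Fintype.card ι * C with hM
  have hM0 : 0 ≤ M := by positivity
  have hsum : ∀ u ≤ t, ∀ i j, Summable fun k => orderedTerm A k u t i j := by
    intro u hu i j
    refine Summable.of_norm_bounded (Real.summable_pow_div_factorial (M * (t - u))) fun k => ?_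
    rw [Real.norm_eq_abs, mul_pow, mul_div_assoc]
    exact orderedTerm_bound hC0 hC t k u hu i j
  have key : HasSum (fun k => ∫ u in s..t, (A u * orderedTerm A k u t) i j)
      (∫ u in s..t, (A u * transitionMatrix A u t) i j) := by
    refine intervalIntegral.hasSum_integral_of_dominated_convergence
      (fun k _ => M * ((M * (t - s)) ^ k / (k.factorial : ℝ))) ?_ ?_ ?_ ?_ ?_
    · intro k
      simp only [Matrix.mul_apply]
      refine Measurable.aestronglyMeasurable ?_
      exact Finset.measurable_sum _ fun l _ =>
        (hm i l).mul (orderedTerm_continuous hm hC t k l j).measurable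
    · intro k
      refine Eventually.of_forall fun u hu => ?_
      rw [Set.uIoc_of_le hst] at hu
      rw [Real.norm_eq_abs]
      refine mul_entry_bound hC0 hC (fun i j => ?_) u i j
      refine (orderedTerm_bound hC0 hC t k u hu.2 i j).trans ?_
      rw [mul_pow M, mul_div_assoc]
      have h0 : 0 ≤ t - u := by linarith [hu.2]
      have h1 : t - u ≤ t - s := by linarith [hu.1]
      gcongr
    · exact Eventually.of_forall fun u _ => (Real.summable_pow_div_factorial _).mul_left M
    · exact intervalIntegrable_const
    · refine Eventually.of_forall fun u hu => ?_
      rw [Set.uIoc_of_le hst] at hu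
      simp only [Matrix.mul_apply, transitionMatrix, Matrix.of_apply]
      exact hasSum_sum fun l _ => (hsum u hu.2 l j).hasSum.mul_left _
  have h := (hsum s hst i j).tsum_eq_zero_add
  simp only [transitionMatrix, Matrix.of_apply] at key ⊢
  rw [h]
  simp only [orderedTerm, Matrix.of_apply]
  rw [key.tsum_eq]

end TransitionMatrix

section Model

/-! The `K = m + 1` states are the elements of `Fin (m + 1)`; the default state `K` is
`Fin.last m`, and the other states are the `Fin.castSucc i` with `i : Fin m`. -/

variable {m : ℕ} {Ω : Type*}

/-- The total rate `λ_i(x) = ∑_{k ≠ i} λ_{i,k}(x)` of leaving state `i`. -/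
noncomputable def exitRate (lam : Fin (m + 1) → Fin (m + 1) → ℝ →ᵇ ℝ) (i : Fin (m + 1))
    (x : ℝ) : ℝ :=
  ∑ k ∈ Finset.univ.erase i, lam i k x

/-- The rate matrix at the value `x` of the common factor: off-diagonal entries `λ_{i,j}(x)`,
diagonal entries `-λ_i(x)`. -/
noncomputable def rateMatrix (lam : Fin (m + 1) → Fin (m + 1) → ℝ →ᵇ ℝ) (x : ℝ) :
    Matrix (Fin (m + 1)) (Fin (m + 1)) ℝ :=
  Matrix.of fun i j => if i = j then -exitRate lam i x else lam i j x

/-- `P_X(s, t)`: the (random) transition matrix on `[s, t]`, `0 ≤ s ≤ t`, generated by the rate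
matrices `A_X(u)` along the path of `X`. -/
noncomputable def transX (lam : Fin (m + 1) → Fin (m + 1) → ℝ →ᵇ ℝ) (X : ℝ≥0 → Ω → ℝ) (ω : Ω)
    (s t : ℝ≥0) : Matrix (Fin (m + 1)) (Fin (m + 1)) ℝ :=
  transitionMatrix (fun u : ℝ => rateMatrix lam (X u.toNNReal ω)) s t

/-- `P*_X(s, t)`: the last row of `P_X(s, t)` is deleted. -/
noncomputable def transXStar (lam : Fin (m + 1) → Fin (m + 1) → ℝ →ᵇ ℝ) (X : ℝ≥0 → Ω → ℝ)
    (ω : Ω) (s t : ℝ≥0) : Matrix (Fin m) (Fin (m + 1)) ℝ :=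
  (transX lam X ω s t).submatrix Fin.castSucc id

/-- `P**_X(s, t)`: the last row and the last column of `P_X(s, t)` are deleted. -/
noncomputable def transXStarStar (lam : Fin (m + 1) → Fin (m + 1) → ℝ →ᵇ ℝ) (X : ℝ≥0 → Ω → ℝ)
    (ω : Ω) (s t : ℝ≥0) : Matrix (Fin m) (Fin m) ℝ :=
  (transX lam X ω s t).submatrix Fin.castSucc Fin.castSucc

/-- The payment dates `N_i = i N`. -/
noncomputable def payDate (N : ℝ≥0) (i : ℕ) : ℝ≥0 := i * N

/-- The ordered product `P**_X(N_0, N_1) P**_X(N_1, N_2) ⋯ P**_X(N_{i-1}, N_i)`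
(the identity matrix if `i = 0`). -/
noncomputable def survivalProd (lam : Fin (m + 1) → Fin (m + 1) → ℝ →ᵇ ℝ) (X : ℝ≥0 → Ω → ℝ)
    (N : ℝ≥0) (ω : Ω) (i : ℕ) : Matrix (Fin m) (Fin m) ℝ :=
  ((List.range i).map fun j =>
    transXStarStar lam X ω (payDate N j) (payDate N (j + 1))).prod

/-- `∫_a^b λ_K(X_u) du`, the integrated rate of leaving the default state. -/
noncomputable def defaultExitIntegral (lam : Fin (m + 1) → Fin (m + 1) → ℝ →ᵇ ℝ)
    (X : ℝ≥0 → Ω → ℝ) (ω : Ω) (a b : ℝ≥0) : ℝ :=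
  ∫ u in (a : ℝ)..(b : ℝ), exitRate lam (Fin.last m) (X u.toNNReal ω)

/-- Recorded default time `τ_r = inf {N_i : S_{N_i} = K}`, with `inf ∅ = ∞`. -/
noncomputable def recordedDefault (N : ℝ≥0) (S : ℝ≥0 → Ω → Fin (m + 1)) (ω : Ω) : ℝ≥0∞ :=
  sInf {x : ℝ≥0∞ | ∃ i : ℕ, x = (payDate N i : ℝ≥0∞) ∧ S (payDate N i) ω = Fin.last m}

/-- Economic default time `τ_e = sup {t ≤ τ_r : S_t ≠ K}`. -/
noncomputable def economicDefault (N : ℝ≥0) (S : ℝ≥0 → Ω → Fin (m + 1)) (ω : Ω) : ℝ≥0∞ :=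
  sSup {x : ℝ≥0∞ | ∃ t : ℝ≥0, x = (t : ℝ≥0∞) ∧ (t : ℝ≥0∞) ≤ recordedDefault N S ω ∧
    S t ω ≠ Fin.last m}

/-- `𝒢_∞ = σ(X_u : u ≥ 0)`. -/
abbrev sigmaX (X : ℝ≥0 → Ω → ℝ) : MeasurableSpace Ω :=
  ⨆ u : ℝ≥0, MeasurableSpace.comap (X u) inferInstance

/-- `σ(S_u : u ≤ s)`. -/
abbrev sigmaS (S : ℝ≥0 → Ω → Fin (m + 1)) (s : ℝ≥0) : MeasurableSpace Ω :=
  ⨆ u : ℝ≥0, ⨆ _ : u ≤ s, MeasurableSpace.comap (S u) inferInstance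

/-- Right-continuous paths with left limits. -/
def IsRCLL (X : ℝ≥0 → Ω → ℝ) : Prop :=
  ∀ ω t, ContinuousWithinAt (fun u => X u ω) (Set.Ici t) t ∧
    ∃ l : ℝ, Tendsto (fun u => X u ω) (𝓝[<] t) (𝓝 l)

/-- `S` is a continuous-time Markov chain with stochastic transition rates `λ_{i,j}(X_s)`: it has
right-continuous paths and, given the whole path of `X`, it is a (time-inhomogeneous) Markov chain
whose transition matrices `P_X(s, t)` are those generated by the rate matrices `A_X(u)`. -/
structure IsChainWithRates [MeasurableSpace Ω] (μ : Measure Ω)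
    (lam : Fin (m + 1) → Fin (m + 1) → ℝ →ᵇ ℝ) (X : ℝ≥0 → Ω → ℝ)
    (S : ℝ≥0 → Ω → Fin (m + 1)) : Prop where
  measurable : ∀ t, Measurable (S t)
  rightContinuous : ∀ ω t, ContinuousWithinAt (fun u => S u ω) (Set.Ici t) t
  markov : ∀ s t : ℝ≥0, s ≤ t → ∀ j : Fin (m + 1),
    μ⟦{ω | S t ω = j} | sigmaX X ⊔ sigmaS S s⟧ =ᵐ[μ] fun ω => transX lam X ω s t (S s ω) j

end Model

end CommonFactorChain

/-!
The conditional law of the recorded state given the path of `X` is computed by repeatedly peeling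
off the last observation. If `E` is an event of `sigmaX X ⊔ sigmaS S s` on which `S s = i`, the
tower property and the Markov property give `P(E, S_t = j | X) = P(E | X) P_X(s, t)_{ij}`
(`condExp_inter_state`); here `P_X(s, t)` can be pulled out because it depends measurably on the
path of `X` (`measurable_transX`). Applied along the payment dates this produces the products of the
matrices `P**_X` and `P*_X` (`condExp_survivalEvent_inter`).

Pathwise, `τ_e ∈ (N_i, N_i + t]` means that no default is observed at `N_0, …, N_i` and that `S`
is in the default state throughout `[N_i + t, N_{i+1}]` (`economicDefault_mem_Ioc_iff`). The
probability of staying there is the limit of the probabilities of being there at the points of ever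
finer partitions, by right-continuity of `S` (`eventually_mem_gridStay_iff`). These are products of
diagonal entries of transition matrices, and such an entry is `exp (-∫ λ_K)` up to an error of
second order in the length of the interval (`abs_transitionMatrix_diag_sub_exp_le`), so that the products
tend to `exp (-∫ λ_K)` over the whole interval (`condExp_inter_defaultStay`).

The event `τ_r < ∞, τ_r - τ_e > t` is the disjoint union over `i` of the events
`N_i < τ_e < N_{i+1} - t` (`lag_gt_iff`). The strict upper bound is harmless, since the conditional
law of `S_t` is left-continuous in `t` (`tendsto_condExp_inter_state`), and conditional
probabilities are countably additive (`hasSum_condExp_indicator_one`).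
-/

namespace CommonFactorChain

/-! ### Estimates and measurability for the time-ordered exponential -/

section TransitionMatrixEstimates

variable {ι : Type*} [Fintype ι] [DecidableEq ι]

theorem hasSum_transitionMatrix {A : ℝ → Matrix ι ι ℝ} {C : ℝ} (hC : ∀ u i j, |A u i j| ≤ C)
    {s t : ℝ} (hst : s ≤ t) (i j : ι) :
    HasSum (fun k => orderedTerm A k s t i j) (transitionMatrix A s t i j) := by
  have hC0 : 0 ≤ C := (abs_nonneg _).trans (hC s i j)
  refine Summable.hasSum ?_
  refine Summable.of_norm_bounded
    (Real.summable_pow_div_factorial (Fintype.card ι * C * (t - s))) fun k => ?_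
  rw [Real.norm_eq_abs, mul_pow, mul_div_assoc]
  exact orderedTerm_bound hC0 hC t k s hst i j

/-- The remainder of the time-ordered exponential is dominated, at every order, by the
corresponding remainder of the scalar exponential series. -/
theorem abs_transitionMatrix_sub_sum_le {A : ℝ → Matrix ι ι ℝ} {C : ℝ}
    (hC : ∀ u i j, |A u i j| ≤ C) {s t : ℝ} (hst : s ≤ t) (i j : ι) (n : ℕ) :
    |transitionMatrix A s t i j - ∑ k ∈ Finset.range n, orderedTerm A k s t i j| ≤
      Real.exp (Fintype.card ι * C * (t - s)) -
        ∑ k ∈ Finset.range n, (Fintype.card ι * C * (t - s)) ^ k / (k.factorial : ℝ) := by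
  have hC0 : 0 ≤ C := (abs_nonneg _).trans (hC s i j)
  have hexp : HasSum (fun k : ℕ => (Fintype.card ι * C * (t - s)) ^ k / (k.factorial : ℝ))
      (Real.exp (Fintype.card ι * C * (t - s))) := by
    rw [Real.exp_eq_exp_ℝ]
    exact NormedSpace.expSeries_div_hasSum_exp _
  have h1 := (hasSum_nat_add_iff' n).2 (hasSum_transitionMatrix hC hst i j)
  have h2 := (hasSum_nat_add_iff' n).2 hexp
  rw [← h1.tsum_eq, ← Real.norm_eq_abs]
  refine tsum_of_norm_bounded h2 fun k => ?_
  rw [Real.norm_eq_abs, mul_pow, mul_div_assoc]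
  exact orderedTerm_bound hC0 hC t _ s hst i j

theorem abs_transitionMatrix_le {A : ℝ → Matrix ι ι ℝ} {C : ℝ}
    (hC : ∀ u i j, |A u i j| ≤ C) {s t : ℝ} (hst : s ≤ t) (i j : ι) :
    |transitionMatrix A s t i j| ≤ Real.exp (Fintype.card ι * C * (t - s)) := by
  simpa using abs_transitionMatrix_sub_sum_le hC hst i j 0

theorem abs_transitionMatrix_sub_one_le {A : ℝ → Matrix ι ι ℝ} {C : ℝ}
    (hC : ∀ u i j, |A u i j| ≤ C) {s t : ℝ} (hst : s ≤ t) (i j : ι) :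
    |transitionMatrix A s t i j - (1 : Matrix ι ι ℝ) i j| ≤
      Real.exp (Fintype.card ι * C * (t - s)) - 1 := by
  simpa [orderedTerm] using abs_transitionMatrix_sub_sum_le hC hst i j 1

/-- Over a short interval, a diagonal entry of the transition matrix agrees with the probability of
no exit up to second order. -/
theorem abs_transitionMatrix_diag_sub_exp_le {A : ℝ → Matrix ι ι ℝ} {C : ℝ}
    (hC : ∀ u i j, |A u i j| ≤ C) {s t : ℝ} (hst : s ≤ t) (i : ι)
    (hsmall : Fintype.card ι * C * (t - s) ≤ 1) :
    |transitionMatrix A s t i i - Real.exp (∫ u in s..t, A u i i)| ≤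
      2 * (Fintype.card ι * C * (t - s)) ^ 2 := by
  have hC0 : 0 ≤ C := (abs_nonneg _).trans (hC s i i)
  have hts : 0 ≤ t - s := sub_nonneg.2 hst
  set x : ℝ := Fintype.card ι * C * (t - s) with hx
  have hx0 : 0 ≤ x := by positivity
  have hI : |∫ u in s..t, A u i i| ≤ x := by
    have h := intervalIntegral.norm_integral_le_of_norm_le_const (a := s) (b := t) (C := C)
      (f := fun u => A u i i) fun u _ => hC u i i
    rw [Real.norm_eq_abs, abs_of_nonneg hts] at h
    refine h.trans ?_
    have hcard : (1 : ℝ) ≤ Fintype.card ι := by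
      exact_mod_cast Fintype.card_pos_iff.2 ⟨i⟩
    rw [hx]
    gcongr
    exact le_mul_of_one_le_left hC0 hcard
  have h1 : |transitionMatrix A s t i i - (1 + ∫ u in s..t, A u i i)| ≤ x ^ 2 := by
    have h := abs_transitionMatrix_sub_sum_le hC hst i i 2
    rw [Finset.sum_range_succ, Finset.sum_range_one, Finset.sum_range_succ,
      Finset.sum_range_one] at h
    simp only [orderedTerm, Matrix.of_apply, Matrix.one_apply_eq, mul_one, ← hx, pow_zero, pow_one,
      Nat.factorial, Nat.cast_one, div_one, ← sub_sub] at h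
    have h' := Real.abs_exp_sub_one_sub_id_le (x := x) (by rwa [abs_of_nonneg hx0])
    rw [← sub_sub]
    exact h.trans ((le_abs_self _).trans h')
  have h2 : |Real.exp (∫ u in s..t, A u i i) - 1 - ∫ u in s..t, A u i i| ≤ x ^ 2 := by
    refine (Real.abs_exp_sub_one_sub_id_le (hI.trans hsmall)).trans ?_
    rw [← sq_abs]
    gcongr
  rw [abs_le] at *
  constructor <;> linarith

theorem abs_prod_range_sub_prod_range_le {a b : ℕ → ℝ} {B ε : ℝ} (hB : 1 ≤ B)
    (ha : ∀ k, |a k| ≤ B) (hb : ∀ k, |b k| ≤ B) (hab : ∀ k, |a k - b k| ≤ ε) (n : ℕ) :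
    |∏ k ∈ Finset.range n, a k - ∏ k ∈ Finset.range n, b k| ≤ n * B ^ n * ε := by
  have hε : 0 ≤ ε := (abs_nonneg _).trans (hab 0)
  have hB0 : 0 ≤ B := zero_le_one.trans hB
  have hprod : ∀ n, |∏ k ∈ Finset.range n, a k| ≤ B ^ n := fun n => by
    rw [Finset.abs_prod]
    exact (Finset.prod_le_prod (fun _ _ => abs_nonneg _) fun k _ => ha k).trans (by simp)
  induction n with
  | zero => simp
  | succ n ih =>
    rw [Finset.prod_range_succ, Finset.prod_range_succ]
    have hsplit : (∏ k ∈ Finset.range n, a k) * a n - (∏ k ∈ Finset.range n, b k) * b n =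
        (∏ k ∈ Finset.range n, a k) * (a n - b n) +
          (∏ k ∈ Finset.range n, a k - ∏ k ∈ Finset.range n, b k) * b n := by ring
    rw [hsplit]
    refine (abs_add_le _ _).trans ?_
    rw [abs_mul, abs_mul]
    have h1 : |∏ k ∈ Finset.range n, a k| * |a n - b n| ≤ B ^ (n + 1) * ε :=
      mul_le_mul ((hprod n).trans (pow_le_pow_right₀ hB n.le_succ)) (hab n) (abs_nonneg _)
        (by positivity)
    have h2 := mul_le_mul ih (hb n) (abs_nonneg _) (by positivity)
    push_cast
    calc _ ≤ B ^ (n + 1) * ε + n * B ^ n * ε * B := add_le_add h1 h2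
      _ = _ := by ring

/-- The `k`-th point of the partition of `[a, a + d]` into `n + 1` equal intervals. -/
noncomputable def gridPoint (a d : ℝ≥0) (n k : ℕ) : ℝ≥0 := a + k * (d / (n + 1))

theorem gridPoint_zero (a d : ℝ≥0) (n : ℕ) : gridPoint a d n 0 = a := by simp [gridPoint]

theorem gridPoint_last (a d : ℝ≥0) (n : ℕ) : gridPoint a d n (n + 1) = a + d := by
  simp only [gridPoint]
  congr 1
  push_cast
  field_simp

theorem gridPoint_mono (a d : ℝ≥0) (n : ℕ) : Monotone (gridPoint a d n) := fun k l h => by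
  unfold gridPoint
  gcongr

theorem gridPoint_succ_sub (a d : ℝ≥0) (n k : ℕ) :
    (gridPoint a d n (k + 1) : ℝ) - gridPoint a d n k = d / (n + 1) := by
  simp only [gridPoint]
  push_cast
  ring

/-- The product of the diagonal entries over the intervals of a fine partition tends to the
probability of no exit. -/
theorem tendsto_prod_transitionMatrix_diag {A : ℝ → Matrix ι ι ℝ} {C : ℝ}
    (hm : ∀ i j, Measurable fun u => A u i j) (hC : ∀ u i j, |A u i j| ≤ C)
    (a d : ℝ≥0) (i : ι) :
    Tendsto (fun n : ℕ => ∏ k ∈ Finset.range (n + 1),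
        transitionMatrix A (gridPoint a d n k) (gridPoint a d n (k + 1)) i i) atTop
      (𝓝 (Real.exp (∫ u in (a : ℝ)..((a + d : ℝ≥0) : ℝ), A u i i))) := by
  have hC0 : 0 ≤ C := (abs_nonneg _).trans (hC 0 i i)
  set M : ℝ := Fintype.card ι * C with hM
  have hM0 : 0 ≤ M := by positivity
  have hcard : (1 : ℝ) ≤ Fintype.card ι := by
    exact_mod_cast Fintype.card_pos_iff.2 ⟨i⟩
  have hCM : C ≤ M := le_mul_of_one_le_left hC0 hcard
  have hint : ∀ x y : ℝ, IntervalIntegrable (fun u => A u i i) volume x y := fun x y =>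
    (intervalIntegrable_const (c := C)).mono_fun (hm i i).aestronglyMeasurable
      (Eventually.of_forall fun u => by
        simpa only [Real.norm_eq_abs] using (hC u i i).trans (le_abs_self C))
  have hle : ∀ n k, (gridPoint a d n k : ℝ) ≤ gridPoint a d n (k + 1) := fun n k => by
    exact_mod_cast gridPoint_mono a d n k.le_succ
  have hexp : ∀ n : ℕ, Real.exp (∫ u in (a : ℝ)..((a + d : ℝ≥0) : ℝ), A u i i) =
      ∏ k ∈ Finset.range (n + 1),
        Real.exp (∫ u in (gridPoint a d n k : ℝ)..(gridPoint a d n (k + 1) : ℝ), A u i i) := by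
    intro n
    rw [← Real.exp_sum,
      intervalIntegral.sum_integral_adjacent_intervals (a := fun k => (gridPoint a d n k : ℝ))
        fun k _ => hint _ _, gridPoint_zero, gridPoint_last]
  have hbound : ∀ᶠ n : ℕ in atTop, ‖∏ k ∈ Finset.range (n + 1),
        transitionMatrix A (gridPoint a d n k) (gridPoint a d n (k + 1)) i i -
      Real.exp (∫ u in (a : ℝ)..((a + d : ℝ≥0) : ℝ), A u i i)‖ ≤
        Real.exp (M * d) * 2 * (M * d) ^ 2 * (1 / ((n : ℝ) + 1)) := by
    have hlim : Tendsto (fun n : ℕ => M * d * (1 / ((n : ℝ) + 1))) atTop (𝓝 (M * d * 0)) :=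
      tendsto_one_div_add_atTop_nhds_zero_nat.const_mul _
    rw [mul_zero] at hlim
    filter_upwards [hlim.eventually_le_const zero_lt_one] with n hn
    have hn' : M * (d / ((n : ℝ) + 1)) ≤ 1 := by
      rw [mul_one_div] at hn
      rwa [← mul_div_assoc]
    rw [hexp n, Real.norm_eq_abs]
    refine (abs_prod_range_sub_prod_range_le (B := Real.exp (M * (d / ((n : ℝ) + 1))))
      (ε := 2 * (M * (d / ((n : ℝ) + 1))) ^ 2) ?_ ?_ ?_ ?_ (n + 1)).trans (le_of_eq ?_)
    · exact Real.one_le_exp (by positivity)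
    · intro k
      have h := abs_transitionMatrix_le hC (hle n k) i i
      rwa [gridPoint_succ_sub] at h
    · intro k
      rw [Real.abs_exp, Real.exp_le_exp]
      have h := intervalIntegral.norm_integral_le_of_norm_le_const
        (a := (gridPoint a d n k : ℝ)) (b := (gridPoint a d n (k + 1) : ℝ)) (C := C)
        (f := fun u => A u i i) fun u _ => hC u i i
      rw [gridPoint_succ_sub, Real.norm_eq_abs,
        abs_of_nonneg (a := (d : ℝ) / (n + 1)) (by positivity)] at h
      exact (le_abs_self _).trans (h.trans (by gcongr))
    · intro k
      have h := abs_transitionMatrix_diag_sub_exp_le hC (hle n k) i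
      rw [gridPoint_succ_sub] at h
      exact h hn'
    · rw [← Real.exp_nat_mul]
      push_cast
      have : ((n : ℝ) + 1) * (M * (d / ((n : ℝ) + 1))) = M * d := by field_simp
      rw [this]
      field_simp
  rw [tendsto_iff_norm_sub_tendsto_zero]
  refine squeeze_zero' (Eventually.of_forall fun _ => norm_nonneg _) hbound ?_
  have h := tendsto_one_div_add_atTop_nhds_zero_nat (𝕜 := ℝ) |>.const_mul
    (Real.exp (M * d) * 2 * (M * d) ^ 2)
  rwa [mul_zero] at h

variable {Ω : Type*} [MeasurableSpace Ω]

theorem measurable_integral_of_measurable_prod {f : ℝ × Ω → ℝ} (hf : Measurable f) (a b : ℝ) :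
    Measurable fun ω => ∫ u in a..b, f (u, ω) := by
  have h : ∀ a b : ℝ, Measurable fun ω => ∫ u in Set.Ioc a b, f (u, ω) := fun a b =>
    (StronglyMeasurable.integral_prod_left (μ := volume.restrict (Set.Ioc a b)) 
      (f := fun u ω => f (u, ω)) hf.stronglyMeasurable).measurable
  exact (h a b).sub (h b a)

theorem measurable_orderedTerm {A : Ω → ℝ → Matrix ι ι ℝ} {C : ℝ}
    (hm : ∀ i j, Measurable fun p : ℝ × Ω => A p.2 p.1 i j) (hC : ∀ ω u i j, |A ω u i j| ≤ C)
    (t : ℝ) (k : ℕ) (i j : ι) :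
    Measurable fun p : ℝ × Ω => orderedTerm (A p.2) k p.1 t i j := by
  induction k generalizing i j with
  | zero => simpa only [orderedTerm] using measurable_const
  | succ k ih =>
    -- continuous in the time variable and measurable in `ω`, hence jointly measurable
    refine measurable_uncurry_of_continuous_of_measurable
      (u := fun s ω => orderedTerm (A ω) (k + 1) s t i j) (fun ω => ?_) fun s => ?_
    · exact orderedTerm_continuous (fun i j => (hm i j).comp measurable_prodMk_right) (hC ω) t _ i j
    · simp only [orderedTerm, Matrix.of_apply, Matrix.mul_apply]
      exact measurable_integral_of_measurable_prod
        (f := fun p => ∑ l, A p.2 p.1 i l * orderedTerm (A p.2) k p.1 t l j)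
        (Finset.measurable_sum _ fun l _ => (hm i l).mul (ih l j)) s t

theorem measurable_transitionMatrix {A : Ω → ℝ → Matrix ι ι ℝ} {C : ℝ}
    (hm : ∀ i j, Measurable fun p : ℝ × Ω => A p.2 p.1 i j) (hC : ∀ ω u i j, |A ω u i j| ≤ C)
    {s t : ℝ} (hst : s ≤ t) (i j : ι) :
    Measurable fun ω => transitionMatrix (A ω) s t i j := by
  refine measurable_of_tendsto_metrizable
    (f := fun n ω => ∑ k ∈ Finset.range n, orderedTerm (A ω) k s t i j) (fun n => ?_) ?_
  · exact Finset.measurable_sum _ fun k _ =>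
      (measurable_orderedTerm hm hC t k i j).comp measurable_prodMk_left
  · rw [tendsto_pi_nhds]
    exact fun ω => (hasSum_transitionMatrix (hC ω) hst i j).tendsto_sum_nat

end TransitionMatrixEstimates

/-! ### Transition matrices along the path of the common factor -/

section CommonFactor

variable {m : ℕ} {Ω : Type*}

/-- A uniform bound on the entries of the rate matrices. -/
noncomputable def rateBound (lam : Fin (m + 1) → Fin (m + 1) → ℝ →ᵇ ℝ) : ℝ :=
  ∑ i, ∑ j, ‖lam i j‖

theorem abs_rateMatrix_le (lam : Fin (m + 1) → Fin (m + 1) → ℝ →ᵇ ℝ) (x : ℝ)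
    (i j : Fin (m + 1)) : |rateMatrix lam x i j| ≤ rateBound lam := by
  have hrow : ∑ j, ‖lam i j‖ ≤ rateBound lam :=
    Finset.single_le_sum (f := fun i => ∑ j, ‖lam i j‖)
      (fun _ _ => Finset.sum_nonneg fun _ _ => norm_nonneg _) (Finset.mem_univ i)
  refine le_trans ?_ hrow
  simp only [rateMatrix, Matrix.of_apply]
  split_ifs
  · rw [abs_neg, exitRate]
    refine (Finset.abs_sum_le_sum_abs _ _).trans ?_
    refine (Finset.sum_le_sum fun k _ => (lam i k).norm_coe_le_norm x).trans ?_
    exact Finset.sum_le_sum_of_subset_of_nonneg (Finset.erase_subset _ _)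
      fun _ _ _ => norm_nonneg _
  · exact ((lam i j).norm_coe_le_norm x).trans
      (Finset.single_le_sum (f := fun j => ‖lam i j‖) (fun _ _ => norm_nonneg _)
        (Finset.mem_univ j))

theorem rateMatrix_last_last (lam : Fin (m + 1) → Fin (m + 1) → ℝ →ᵇ ℝ) (x : ℝ) :
    rateMatrix lam x (Fin.last m) (Fin.last m) = -exitRate lam (Fin.last m) x := by
  simp [rateMatrix]

theorem continuous_rateMatrix (lam : Fin (m + 1) → Fin (m + 1) → ℝ →ᵇ ℝ) (i j : Fin (m + 1)) :
    Continuous fun x => rateMatrix lam x i j := by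
  simp only [rateMatrix, Matrix.of_apply, exitRate]
  split_ifs
  · fun_prop
  · fun_prop

/-- A right-continuous process is jointly measurable: it is the limit of its discretizations from
the right. -/
theorem measurable_uncurry_of_rightContinuous [MeasurableSpace Ω] {X : ℝ≥0 → Ω → ℝ}
    (hmeas : ∀ t, Measurable (X t))
    (hX : ∀ ω t, ContinuousWithinAt (fun u => X u ω) (Set.Ici t) t) :
    Measurable fun p : ℝ≥0 × Ω => X p.1 p.2 := by
  refine measurable_of_tendsto_metrizable
    (f := fun (n : ℕ) (p : ℝ≥0 × Ω) => X ((⌊((n : ℝ≥0) + 1) * p.1⌋₊ + 1) / ((n : ℝ≥0) + 1)) p.2)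
    (fun n => ?_) ?_
  · have h : Measurable fun q : ℕ × Ω => X (((q.1 : ℝ≥0) + 1) / ((n : ℝ≥0) + 1)) q.2 :=
      by
      refine measurable_from_prod_countable_right fun k => ?_
      exact hmeas (((k : ℝ≥0) + 1) / ((n : ℝ≥0) + 1))
    have h2 : Measurable fun p : ℝ≥0 × Ω => (⌊((n : ℝ≥0) + 1) * p.1⌋₊, p.2) :=
      (Nat.measurable_floor.comp (measurable_const.mul measurable_fst)).prodMk measurable_snd
    exact (h.comp h2 :)
  · rw [tendsto_pi_nhds]
    rintro ⟨u, ω⟩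
    refine (hX ω u).tendsto.comp (tendsto_nhdsWithin_iff.2 ⟨?_, Eventually.of_forall fun n => ?_⟩)
    · have hlim : Tendsto (fun n : ℕ => u + 1 / ((n : ℝ≥0) + 1)) atTop (𝓝 (u + 0)) :=
        tendsto_one_div_add_atTop_nhds_zero_nat.const_add u
      rw [add_zero] at hlim
      refine tendsto_of_tendsto_of_tendsto_of_le_of_le tendsto_const_nhds hlim (fun n => ?_)
        fun n => ?_
      · rw [le_div_iff₀ (by positivity), mul_comm]
        exact (Nat.lt_floor_add_one _).le
      · rw [add_div]
        gcongr
        rw [div_le_iff₀ (by positivity), mul_comm u]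
        exact Nat.floor_le (by positivity)
    · rw [Set.mem_Ici, le_div_iff₀ (by positivity), mul_comm]
      exact (Nat.lt_floor_add_one _).le

variable (lam : Fin (m + 1) → Fin (m + 1) → ℝ →ᵇ ℝ) {X : ℝ≥0 → Ω → ℝ}

theorem measurable_rateMatrix_path (hX : IsRCLL X) (i j : Fin (m + 1)) :
    Measurable[Prod.instMeasurableSpace (m₂ := sigmaX X)]
      fun p : ℝ × Ω => rateMatrix lam (X p.1.toNNReal p.2) i j := by
  let _ : MeasurableSpace Ω := sigmaX X
  have hXm : ∀ t, Measurable (X t) := fun t =>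
    Measurable.of_comap_le (le_iSup (fun u => MeasurableSpace.comap (X u) inferInstance) t)
  have h := measurable_uncurry_of_rightContinuous hXm fun ω t => (hX ω t).1
  exact (continuous_rateMatrix lam i j).measurable.comp
    (h.comp ((measurable_real_toNNReal.comp measurable_fst).prodMk measurable_snd))

theorem measurable_transX (hX : IsRCLL X) {s t : ℝ≥0} (hst : s ≤ t) (i j : Fin (m + 1)) :
    Measurable[sigmaX X] fun ω => transX lam X ω s t i j :=
  @measurable_transitionMatrix _ _ _ _ (sigmaX X) _ _ (measurable_rateMatrix_path lam hX)
    (fun _ _ => abs_rateMatrix_le lam _) _ _ (by exact_mod_cast hst) i j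

theorem intervalIntegrable_exitRate_path (hX : IsRCLL X) (ω : Ω) (a b : ℝ) :
    IntervalIntegrable (fun u : ℝ => exitRate lam (Fin.last m) (X u.toNNReal ω)) volume a b := by
  let _ : MeasurableSpace Ω := sigmaX X
  have h : IntervalIntegrable
      (fun u : ℝ => rateMatrix lam (X u.toNNReal ω) (Fin.last m) (Fin.last m)) volume a b :=
    (intervalIntegrable_const (c := rateBound lam)).mono_fun
      ((measurable_rateMatrix_path lam hX _ _).comp measurable_prodMk_right).aestronglyMeasurable
      (Eventually.of_forall fun u => by
        simpa only [Real.norm_eq_abs] using (abs_rateMatrix_le lam _ _ _).trans (le_abs_self _))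
  simp only [rateMatrix_last_last] at h
  simpa only [Pi.neg_def, neg_neg] using h.neg

theorem abs_transX_sub_one_le (ω : Ω) {s t : ℝ≥0} (hst : s ≤ t) (i j : Fin (m + 1)) :
    |transX lam X ω s t i j - (1 : Matrix (Fin (m + 1)) (Fin (m + 1)) ℝ) i j| ≤
      Real.exp ((m + 1) * rateBound lam * (t - s)) - 1 := by
  simpa [transX] using abs_transitionMatrix_sub_one_le
    (fun u => abs_rateMatrix_le lam (X u.toNNReal ω)) (NNReal.coe_le_coe.2 hst) i j

theorem tendsto_prod_transX_default (hX : IsRCLL X) (ω : Ω) (a d : ℝ≥0) :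
    Tendsto (fun n : ℕ => ∏ k ∈ Finset.range (n + 1),
        transX lam X ω (gridPoint a d n k) (gridPoint a d n (k + 1)) (Fin.last m) (Fin.last m))
      atTop (𝓝 (Real.exp (-defaultExitIntegral lam X ω a (a + d)))) := by
  let _ : MeasurableSpace Ω := sigmaX X
  have h := tendsto_prod_transitionMatrix_diag
    (A := fun u : ℝ => rateMatrix lam (X u.toNNReal ω))
    (fun i j => (measurable_rateMatrix_path lam hX i j).comp measurable_prodMk_right)
    (fun u => abs_rateMatrix_le lam (X u.toNNReal ω)) a d (Fin.last m)
  simpa only [rateMatrix_last_last, intervalIntegral.integral_neg, transX, defaultExitIntegral]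
    using h

end CommonFactor

/-! ### Limits and sums of conditional probabilities -/

section ConditionalProbability

variable {Ω : Type*} {G : MeasurableSpace Ω} {m₀ : MeasurableSpace Ω} {μ : Measure Ω}

theorem condExp_indicator_one_nonneg (E : Set Ω) : ∀ᵐ ω ∂μ, 0 ≤ (μ⟦E|G⟧) ω :=
  condExp_nonneg (Eventually.of_forall (Set.indicator_nonneg fun _ _ => zero_le_one))

variable [IsProbabilityMeasure μ]

theorem integrable_indicator_one {E : Set Ω} (hE : MeasurableSet E) :
    Integrable (E.indicator fun _ => (1 : ℝ)) μ :=
  (integrable_const 1).indicator hE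

theorem condExp_indicator_one_le_one (hG : G ≤ m₀) {E : Set Ω} (hE : MeasurableSet E) :
    ∀ᵐ ω ∂μ, (μ⟦E|G⟧) ω ≤ 1 := by
  have h := condExp_mono (μ := μ) (m := G) (integrable_indicator_one hE) (integrable_const 1)
    (Eventually.of_forall (Set.indicator_le_self' (f := fun _ => (1 : ℝ)) fun _ _ => zero_le_one))
  filter_upwards [h] with ω hω
  rwa [condExp_const hG] at hω

/-- Passing to the limit in an explicit formula for conditional probabilities. -/
theorem condExp_indicator_one_of_tendsto (hG : G ≤ m₀) {E : ℕ → Set Ω} {F : Set Ω}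
    (hE : ∀ n, MeasurableSet (E n)) (hEF : ∀ ω, ∀ᶠ n in atTop, ω ∈ E n ↔ ω ∈ F)
    {g : ℕ → Ω → ℝ} {f : Ω → ℝ} (hg : ∀ n, μ⟦E n|G⟧ =ᵐ[μ] g n)
    (hgf : ∀ᵐ ω ∂μ, Tendsto (fun n => g n ω) atTop (𝓝 (f ω))) :
    μ⟦F|G⟧ =ᵐ[μ] f := by
  have hlim : ∀ᵐ ω ∂μ, Tendsto (fun n => (μ⟦E n|G⟧) ω) atTop (𝓝 (f ω)) := by
    filter_upwards [hgf, ae_all_iff.2 hg] with ω h1 h2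
    exact h1.congr fun n => (h2 n).symm
  have hbound : ∀ n, ∀ᵐ ω ∂μ, ‖(μ⟦E n|G⟧) ω‖ ≤ 1 := fun n => by
    filter_upwards [condExp_indicator_one_nonneg (μ := μ) (G := G) (E n),
      condExp_indicator_one_le_one (μ := μ) hG (hE n)] with ω h0 h1
    rwa [Real.norm_eq_abs, abs_of_nonneg h0]
  have hfm : AEStronglyMeasurable[G] f μ := by
    refine ⟨fun ω => limsup (fun n => (μ⟦E n|G⟧) ω) atTop, ?_, ?_⟩
    · exact (Measurable.limsup fun n => stronglyMeasurable_condExp.measurable).stronglyMeasurable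
    · filter_upwards [hlim] with ω hω using hω.limsup_eq.symm
  have hfint : Integrable f μ := by
    refine (integrable_const (1 : ℝ)).mono' (hfm.mono hG) ?_
    filter_upwards [hlim, ae_all_iff.2 hbound] with ω h1 h2
    exact le_of_tendsto h1.norm (Eventually.of_forall h2)
  have h := tendsto_condExp_unique (m := G) (μ := μ) (fun n => (E n).indicator fun _ => (1 : ℝ))
    (fun n => μ⟦E n|G⟧) (F.indicator fun _ => (1 : ℝ)) f
    (fun n => integrable_indicator_one (hE n))
    (fun n => integrable_condExp)
    (Eventually.of_forall fun ω => (tendsto_indicator_const_apply_iff_eventually _ _ _).2 (hEF ω))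
    hlim (fun _ => 1) (integrable_const _) (fun _ => 1) (integrable_const _)
    (fun n => Eventually.of_forall fun ω =>
      (norm_indicator_le_norm_self _ ω).trans_eq norm_one) hbound
    (fun n => (condExp_condExp_of_le le_rfl hG).symm)
  exact h.trans (condExp_of_aestronglyMeasurable' hG hfm hfint)

theorem condExp_indicator_one_biUnion {κ : Type*} {B : κ → Set Ω} (hB : ∀ k, MeasurableSet (B k))
    (hdisj : Pairwise (Function.onFun Disjoint B)) (s : Finset κ) :
    μ⟦⋃ k ∈ s, B k|G⟧ =ᵐ[μ] fun ω => ∑ k ∈ s, (μ⟦B k|G⟧) ω := by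
  have h : (⋃ k ∈ s, B k).indicator (fun _ => (1 : ℝ)) =
      ∑ k ∈ s, (B k).indicator fun _ => (1 : ℝ) := by
    rw [Finset.indicator_biUnion _ _ fun i _ j _ hij => hdisj hij]
    ext ω
    simp
  rw [h]
  refine (condExp_finsetSum (fun k _ => integrable_indicator_one (hB k)) G).trans ?_
  refine Eventually.of_forall fun ω => ?_
  simp

/-- Conditional probabilities are countably additive. -/
theorem hasSum_condExp_indicator_one (hG : G ≤ m₀) {B : ℕ → Set Ω}
    (hB : ∀ i, MeasurableSet (B i)) (hdisj : Pairwise (Function.onFun Disjoint B)) :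
    ∀ᵐ ω ∂μ, HasSum (fun i => (μ⟦B i|G⟧) ω) ((μ⟦⋃ i, B i|G⟧) ω) := by
  have hmeas : ∀ n, MeasurableSet (⋃ k ∈ Finset.range n, B k) := fun n =>
    Finset.measurableSet_biUnion _ fun k _ => hB k
  have hsum : ∀ᵐ ω ∂μ, Summable fun i => (μ⟦B i|G⟧) ω := by
    filter_upwards [ae_all_iff.2 fun i => condExp_indicator_one_nonneg (μ := μ) (G := G) (B i),
      ae_all_iff.2 fun n => condExp_indicator_one_le_one (μ := μ) hG (hmeas n),
      ae_all_iff.2 fun n => condExp_indicator_one_biUnion (μ := μ) (G := G) hB hdisj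
        (Finset.range n)] with ω h0 h1 h2
    exact summable_of_sum_range_le h0 fun n => (h2 n).symm.trans_le (h1 n)
  have h := condExp_indicator_one_of_tendsto (μ := μ) hG (F := ⋃ i, B i) hmeas (fun ω => ?_)
    (fun n => condExp_indicator_one_biUnion hB hdisj (Finset.range n))
    (hsum.mono fun ω hω => hω.hasSum.tendsto_sum_nat)
  · filter_upwards [h, hsum] with ω h1 h2
    rw [h1]
    exact h2.hasSum
  · by_cases hω : ∃ i, ω ∈ B i
    · obtain ⟨i, hi⟩ := hω
      filter_upwards [eventually_gt_atTop i] with n hn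
      simp only [Set.mem_iUnion, Finset.mem_range]
      exact ⟨fun ⟨k, _, hk⟩ => ⟨k, hk⟩, fun _ => ⟨i, hn, hi⟩⟩
    · refine Eventually.of_forall fun n => ?_
      simp only [Set.mem_iUnion, Finset.mem_range]
      exact ⟨fun ⟨k, _, hk⟩ => ⟨k, hk⟩, fun h => absurd h hω⟩

end ConditionalProbability

/-! ### The chain given the path of the common factor -/

section Chain

variable {m : ℕ} {Ω : Type*}

theorem measurableSet_sigmaS {S : ℝ≥0 → Ω → Fin (m + 1)} {u s : ℝ≥0} (hus : u ≤ s)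
    (B : Set (Fin (m + 1))) : MeasurableSet[sigmaS S s] {ω | S u ω ∈ B} :=
  (le_iSup₂_of_le (f := fun (u : ℝ≥0) (_ : u ≤ s) => MeasurableSpace.comap (S u) inferInstance)
    u hus le_rfl : MeasurableSpace.comap (S u) inferInstance ≤ sigmaS S s) _
    ⟨B, B.to_countable.measurableSet, rfl⟩

theorem measurableSet_sup_sigmaS (X : ℝ≥0 → Ω → ℝ) {S : ℝ≥0 → Ω → Fin (m + 1)} {u s : ℝ≥0}
    (hus : u ≤ s) (B : Set (Fin (m + 1))) :
    MeasurableSet[sigmaX X ⊔ sigmaS S s] {ω | S u ω ∈ B} :=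
  (le_sup_right : sigmaS S s ≤ sigmaX X ⊔ sigmaS S s) _ (measurableSet_sigmaS hus B)

theorem sup_sigmaS_mono (X : ℝ≥0 → Ω → ℝ) (S : ℝ≥0 → Ω → Fin (m + 1)) {s t : ℝ≥0}
    (hst : s ≤ t) : sigmaX X ⊔ sigmaS S s ≤ sigmaX X ⊔ sigmaS S t :=
  sup_le_sup_left (biSup_mono fun _ hu => hu.trans hst) _

/-- No default is observed at the payment dates `N_0, …, N_i`. -/
def survivalEvent (N : ℝ≥0) (S : ℝ≥0 → Ω → Fin (m + 1)) (i : ℕ) : Set Ω :=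
  {ω | ∀ j ≤ i, S (payDate N j) ω ≠ Fin.last m}

/-- The chain is in the default state throughout `[a, a + d]`. -/
def defaultStay (S : ℝ≥0 → Ω → Fin (m + 1)) (a d : ℝ≥0) : Set Ω :=
  {ω | ∀ u, a ≤ u → u ≤ a + d → S u ω = Fin.last m}

/-- The chain is in the default state at the first `k + 1` points of the `n`-th partition of
`[a, a + d]`. -/
def gridStay (S : ℝ≥0 → Ω → Fin (m + 1)) (a d : ℝ≥0) (n k : ℕ) : Set Ω :=
  {ω | ∀ l ≤ k, S (gridPoint a d n l) ω = Fin.last m}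

theorem payDate_mono (N : ℝ≥0) : Monotone (payDate N) := fun i j h => by
  unfold payDate
  gcongr

theorem payDate_succ (N : ℝ≥0) (i : ℕ) : payDate N (i + 1) = payDate N i + N := by
  simp [payDate, add_mul]

theorem measurableSet_survivalEvent (X : ℝ≥0 → Ω → ℝ) (S : ℝ≥0 → Ω → Fin (m + 1)) (N : ℝ≥0)
    (i : ℕ) : MeasurableSet[sigmaX X ⊔ sigmaS S (payDate N i)] (survivalEvent N S i) := by
  have h : survivalEvent N S i =
      ⋂ j ∈ Set.Iic i, {ω | S (payDate N j) ω ∈ ({Fin.last m}ᶜ : Set (Fin (m + 1)))} := by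
    ext ω
    simp [survivalEvent]
  rw [h]
  exact MeasurableSet.biInter (Set.to_countable _) fun j hj =>
    measurableSet_sup_sigmaS X (payDate_mono N hj) _

theorem measurableSet_gridStay (X : ℝ≥0 → Ω → ℝ) (S : ℝ≥0 → Ω → Fin (m + 1)) (a d : ℝ≥0)
    (n k : ℕ) : MeasurableSet[sigmaX X ⊔ sigmaS S (gridPoint a d n k)] (gridStay S a d n k) := by
  have h : gridStay S a d n k =
      ⋂ j ∈ Set.Iic k, {ω | S (gridPoint a d n j) ω ∈ ({Fin.last m} : Set (Fin (m + 1)))} := by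
    ext ω
    simp [gridStay]
  rw [h]
  exact MeasurableSet.biInter (Set.to_countable _) fun j hj =>
    measurableSet_sup_sigmaS X (gridPoint_mono a d n hj) _

theorem eventually_eq_of_rightContinuous {S : ℝ≥0 → Ω → Fin (m + 1)} {ω : Ω} {t : ℝ≥0}
    (h : ContinuousWithinAt (fun u => S u ω) (Set.Ici t) t) :
    ∃ b, t < b ∧ ∀ u, t ≤ u → u < b → S u ω = S t ω := by
  have h1 : ∀ᶠ u in 𝓝[≥] t, S u ω = S t ω := by
    have := h.tendsto
    rw [nhds_discrete, tendsto_pure] at this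
    exact this
  obtain ⟨b, hb, hsub⟩ := mem_nhdsGE_iff_exists_Ico_subset.1 h1
  exact ⟨b, hb, fun u h1 h2 => hsub ⟨h1, h2⟩⟩

/-- By right-continuity, an excursion out of the default state is seen by every fine partition. -/
theorem eventually_mem_gridStay_iff {S : ℝ≥0 → Ω → Fin (m + 1)}
    (hS : ∀ ω t, ContinuousWithinAt (fun u => S u ω) (Set.Ici t) t) (a d : ℝ≥0) (ω : Ω) :
    ∀ᶠ n in atTop, ω ∈ gridStay S a d n (n + 1) ↔ ω ∈ defaultStay S a d := by
  by_cases hω : ω ∈ defaultStay S a d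
  · refine Eventually.of_forall fun n => iff_of_true (fun l hl => hω _ ?_ ?_) hω
    · exact (gridPoint_zero a d n).symm.trans_le (gridPoint_mono a d n l.zero_le)
    · exact (gridPoint_mono a d n hl).trans_eq (gridPoint_last a d n)
  simp only [iff_false, hω]
  obtain ⟨u, hau, hud, hu⟩ : ∃ u, a ≤ u ∧ u ≤ a + d ∧ S u ω ≠ Fin.last m := by
    simpa [defaultStay] using hω
  rcases eq_or_ne d 0 with rfl | hd
  · refine Eventually.of_forall fun n h => hu ?_
    have hua : u = a := le_antisymm (by simpa using hud) hau
    rw [hua, ← gridPoint_zero a 0 n]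
    exact h 0 (Nat.zero_le _)
  obtain ⟨b, hub, hb⟩ := eventually_eq_of_rightContinuous (hS ω u)
  have hlim : Tendsto (fun n : ℕ => u + d * (1 / ((n : ℝ≥0) + 1))) atTop (𝓝 (u + d * 0)) :=
    (tendsto_one_div_add_atTop_nhds_zero_nat.const_mul d).const_add u
  rw [mul_zero, add_zero] at hlim
  filter_upwards [hlim.eventually_lt_const hub] with n hn hgrid
  have hd0 : 0 < d := pos_iff_ne_zero.2 hd
  obtain ⟨v, rfl⟩ := exists_add_of_le hau
  have hvd : v ≤ d := le_of_add_le_add_left hud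
  set e : ℝ≥0 := d / (n + 1) with he
  have he0 : 0 < e := by positivity
  have hle : v ≤ ⌈v / e⌉₊ * e := (div_le_iff₀ he0).1 (Nat.le_ceil _)
  have hlt : (⌈v / e⌉₊ : ℝ≥0) * e < v + e := by
    have h := mul_lt_mul_of_pos_right (Nat.ceil_lt_add_one (a := v / e) zero_le) he0
    rwa [add_mul, one_mul, div_mul_cancel₀ _ he0.ne'] at h
  have hk : ⌈v / e⌉₊ ≤ n + 1 := by
    refine Nat.ceil_le.2 ((div_le_iff₀ he0).2 (hvd.trans_eq ?_))
    rw [he]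
    push_cast
    field_simp
  refine hu ?_
  rw [← hb (gridPoint a d n ⌈v / e⌉₊)]
  · exact hgrid _ hk
  · rw [gridPoint, ← he]
    gcongr
  · refine lt_of_le_of_lt ?_ hn
    rw [mul_one_div, ← he, gridPoint, ← he, add_assoc]
    gcongr

theorem defaultStay_eq_iInter {S : ℝ≥0 → Ω → Fin (m + 1)}
    (hS : ∀ ω t, ContinuousWithinAt (fun u => S u ω) (Set.Ici t) t) (a d : ℝ≥0) :
    defaultStay S a d = ⋂ n, gridStay S a d n (n + 1) := by
  ext ω
  refine ⟨fun hω => Set.mem_iInter.2 fun n l hl => hω _ ?_ ?_, fun hω => ?_⟩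
  · exact (gridPoint_zero a d n).symm.trans_le (gridPoint_mono a d n l.zero_le)
  · exact (gridPoint_mono a d n hl).trans_eq (gridPoint_last a d n)
  · obtain ⟨n, hn⟩ := (eventually_mem_gridStay_iff hS a d ω).exists
    exact hn.1 (Set.mem_iInter.1 hω n)

theorem survivalEvent_succ_inter (N : ℝ≥0) (S : ℝ≥0 → Ω → Fin (m + 1)) (i : ℕ) (k : Fin m) :
    survivalEvent N S (i + 1) ∩ {ω | S (payDate N (i + 1)) ω = k.castSucc} =
      survivalEvent N S i ∩ {ω | S (payDate N (i + 1)) ω = k.castSucc} := by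
  ext ω
  simp only [survivalEvent, Nat.le_succ_iff, Set.mem_inter_iff, Set.mem_ofPred_eq, or_imp,
    forall_and, forall_eq, and_assoc, and_congr_right_iff, and_iff_right_iff_imp]
  intro _ h
  rw [h]
  exact (Fin.castSucc_lt_last k).ne

theorem survivalProd_succ (lam : Fin (m + 1) → Fin (m + 1) → ℝ →ᵇ ℝ) (X : ℝ≥0 → Ω → ℝ)
    (N : ℝ≥0) (ω : Ω) (i : ℕ) :
    survivalProd lam X N ω (i + 1) =
      survivalProd lam X N ω i * transXStarStar lam X ω (payDate N i) (payDate N (i + 1)) := by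
  simp [survivalProd, List.range_succ]

variable [MeasurableSpace Ω] {μ : Measure Ω} {lam : Fin (m + 1) → Fin (m + 1) → ℝ →ᵇ ℝ}
  {X : ℝ≥0 → Ω → ℝ} {S : ℝ≥0 → Ω → Fin (m + 1)}

theorem sigmaX_le (hXmeas : ∀ t, Measurable (X t)) : sigmaX X ≤ ‹MeasurableSpace Ω› :=
  iSup_le fun t => (hXmeas t).comap_le

theorem sup_sigmaS_le (hXmeas : ∀ t, Measurable (X t)) (hS : IsChainWithRates μ lam X S)
    (s : ℝ≥0) : sigmaX X ⊔ sigmaS S s ≤ ‹MeasurableSpace Ω› :=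
  sup_le (sigmaX_le hXmeas) (iSup₂_le fun t _ => (hS.measurable t).comap_le)

variable [IsProbabilityMeasure μ]

/-- One step of the Markov property given the whole path of `X`. -/
theorem condExp_inter_state (hXmeas : ∀ t, Measurable (X t)) (hX : IsRCLL X)
    (hS : IsChainWithRates μ lam X S) {s t : ℝ≥0} (hst : s ≤ t) {i : Fin (m + 1)} {E : Set Ω}
    (hE : MeasurableSet[sigmaX X ⊔ sigmaS S s] E) (hEi : ∀ ω ∈ E, S s ω = i) (j : Fin (m + 1)) :
    μ⟦E ∩ {ω | S t ω = j}|sigmaX X⟧ =ᵐ[μ]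
      fun ω => (μ⟦E|sigmaX X⟧) ω * transX lam X ω s t i j := by
  have hF := sup_sigmaS_le hXmeas hS s
  have hD : MeasurableSet {ω | S t ω = j} := hS.measurable t (MeasurableSet.singleton j)
  have hE1 : Integrable (E.indicator fun _ => (1 : ℝ)) μ := integrable_indicator_one (hF _ hE)
  have hP : StronglyMeasurable[sigmaX X] fun ω => transX lam X ω s t i j :=
    (measurable_transX lam hX hst i j).stronglyMeasurable
  have h1 : μ⟦E ∩ {ω | S t ω = j}|sigmaX X ⊔ sigmaS S s⟧ =ᵐ[μ]
      (E.indicator fun _ => (1 : ℝ)) * fun ω => transX lam X ω s t i j := by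
    rw [← Set.indicator_indicator]
    refine (condExp_indicator (integrable_indicator_one hD) hE).trans ?_
    filter_upwards [hS.markov s t hst j] with ω hω
    by_cases hωE : ω ∈ E
    · simp [hωE, hω, hEi ω hωE]
    · simp [hωE]
  have hint : Integrable ((E.indicator fun _ => (1 : ℝ)) * fun ω => transX lam X ω s t i j) μ :=
    integrable_condExp.congr h1
  refine (condExp_condExp_of_le le_sup_left hF).symm.trans ?_
  refine (condExp_congr_ae h1).trans ?_
  exact condExp_mul_of_stronglyMeasurable_right hP hint hE1

/-- Law of total conditional probability over the state at time `s`. -/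
theorem condExp_eq_sum_states (hS : ∀ t, Measurable (S t)) (s : ℝ≥0) {E : Set Ω}
    (hE : MeasurableSet E) (G : MeasurableSpace Ω) :
    μ⟦E|G⟧ =ᵐ[μ] fun ω => ∑ k, (μ⟦E ∩ {ω | S s ω = k}|G⟧) ω := by
  have h := condExp_indicator_one_biUnion (μ := μ) (G := G) (B := fun k => E ∩ {ω | S s ω = k})
    (fun k => hE.inter (hS s (MeasurableSet.singleton k)))
    (fun k l hkl => Set.disjoint_left.2 fun ω h1 h2 => hkl (h1.2.symm.trans h2.2)) Finset.univ
  have hU : (⋃ k ∈ (Finset.univ : Finset (Fin (m + 1))), E ∩ {ω | S s ω = k}) = E := by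
    ext ω
    simp
  rwa [hU] at h

/-- Chapman–Kolmogorov for the conditional law of the state on an event of the past. -/
theorem condExp_inter_state_eq_sum (hXmeas : ∀ t, Measurable (X t)) (hX : IsRCLL X)
    (hS : IsChainWithRates μ lam X S) {s t : ℝ≥0} (hst : s ≤ t) {E : Set Ω}
    (hE : MeasurableSet[sigmaX X ⊔ sigmaS S s] E) (j : Fin (m + 1)) :
    μ⟦E ∩ {ω | S t ω = j}|sigmaX X⟧ =ᵐ[μ]
      fun ω => ∑ k, (μ⟦E ∩ {ω | S s ω = k}|sigmaX X⟧) ω * transX lam X ω s t k j := by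
  have hD : MeasurableSet {ω | S t ω = j} := hS.measurable t (MeasurableSet.singleton j)
  have hstep := fun k => condExp_inter_state hXmeas hX hS hst
    (E := E ∩ {ω | S s ω = k}) (i := k)
    (hE.inter (measurableSet_sup_sigmaS X le_rfl {k})) (fun ω hω => hω.2) j
  filter_upwards [condExp_eq_sum_states (μ := μ) hS.measurable s
    ((sup_sigmaS_le hXmeas hS s _ hE).inter hD) (sigmaX X), ae_all_iff.2 hstep] with ω h1 h2
  rw [h1]
  refine Finset.sum_congr rfl fun k _ => ?_
  rw [← h2 k, Set.inter_right_comm]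

theorem condExp_inter_gridStay (hXmeas : ∀ t, Measurable (X t)) (hX : IsRCLL X)
    (hS : IsChainWithRates μ lam X S) {a : ℝ≥0} (d : ℝ≥0) {E : Set Ω}
    (hE : MeasurableSet[sigmaX X ⊔ sigmaS S a] E) (n k : ℕ) :
    μ⟦E ∩ gridStay S a d n k|sigmaX X⟧ =ᵐ[μ]
      fun ω => (μ⟦E ∩ {ω | S a ω = Fin.last m}|sigmaX X⟧) ω * ∏ l ∈ Finset.range k,
        transX lam X ω (gridPoint a d n l) (gridPoint a d n (l + 1)) (Fin.last m) (Fin.last m) := by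
  induction k with
  | zero => simp [gridStay, gridPoint_zero]
  | succ k ih =>
    have hsplit : E ∩ gridStay S a d n (k + 1) =
        (E ∩ gridStay S a d n k) ∩ {ω | S (gridPoint a d n (k + 1)) ω = Fin.last m} := by
      ext ω
      simp only [gridStay, Nat.le_succ_iff, Set.mem_inter_iff, Set.mem_ofPred_eq, or_imp,
        forall_and, forall_eq, and_assoc]
    have ha : a ≤ gridPoint a d n k :=
      (gridPoint_zero a d n).symm.trans_le (gridPoint_mono a d n k.zero_le)
    rw [hsplit]
    filter_upwards [ih, condExp_inter_state hXmeas hX hS (gridPoint_mono a d n k.le_succ)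
      ((sup_sigmaS_mono X S ha _ hE).inter (measurableSet_gridStay X S a d n k))
      (i := Fin.last m) (fun ω hω => hω.2 k le_rfl) (Fin.last m)] with ω h1 h2
    rw [h2, h1, Finset.prod_range_succ, mul_assoc]

/-- The holding probability in the default state is the limit of the probabilities of being there
at the points of ever finer partitions. -/
theorem condExp_inter_defaultStay (hXmeas : ∀ t, Measurable (X t)) (hX : IsRCLL X)
    (hS : IsChainWithRates μ lam X S) {a : ℝ≥0} (d : ℝ≥0) {E : Set Ω}
    (hE : MeasurableSet[sigmaX X ⊔ sigmaS S a] E) :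
    μ⟦E ∩ defaultStay S a d|sigmaX X⟧ =ᵐ[μ]
      fun ω => (μ⟦E ∩ {ω | S a ω = Fin.last m}|sigmaX X⟧) ω *
        Real.exp (-defaultExitIntegral lam X ω a (a + d)) := by
  refine condExp_indicator_one_of_tendsto (sigmaX_le hXmeas)
    (E := fun n => E ∩ gridStay S a d n (n + 1)) (fun n => ?_) (fun ω => ?_)
    (fun n => condExp_inter_gridStay hXmeas hX hS d hE n (n + 1)) ?_
  · exact (sup_sigmaS_le hXmeas hS _ _ hE).inter
      (sup_sigmaS_le hXmeas hS _ _ (measurableSet_gridStay X S a d n (n + 1)))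
  · filter_upwards [eventually_mem_gridStay_iff hS.rightContinuous a d ω] with n hn
    exact and_congr_right fun _ => hn
  · exact Eventually.of_forall fun ω => (tendsto_prod_transX_default lam hX ω a d).const_mul _

/-- The conditional law of the state at a time after the `i`-th payment date, on the event of
survival up to that date, given its law at that date. -/
theorem condExp_survivalEvent_inter_of_payDate (hXmeas : ∀ t, Measurable (X t)) (hX : IsRCLL X)
    (hS : IsChainWithRates μ lam X S) (s₀ : Fin m) (N : ℝ≥0) (i : ℕ)
    (h : ∀ k : Fin m, μ⟦survivalEvent N S i ∩ {ω | S (payDate N i) ω = k.castSucc}|sigmaX X⟧ =ᵐ[μ]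
      fun ω => survivalProd lam X N ω i s₀ k)
    {t : ℝ≥0} (ht : payDate N i ≤ t) (l : Fin (m + 1)) :
    μ⟦survivalEvent N S i ∩ {ω | S t ω = l}|sigmaX X⟧ =ᵐ[μ]
      fun ω => (survivalProd lam X N ω i * transXStar lam X ω (payDate N i) t) s₀ l := by
  have hempty : survivalEvent N S i ∩ {ω | S (payDate N i) ω = Fin.last m} = ∅ :=
    Set.eq_empty_of_forall_notMem fun ω hω => hω.1 i le_rfl hω.2
  filter_upwards [condExp_inter_state_eq_sum hXmeas hX hS ht
    (measurableSet_survivalEvent X S N i) l, ae_all_iff.2 h] with ω h1 h2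
  rw [h1, Fin.sum_univ_castSucc, hempty, Matrix.mul_apply]
  simp [h2, transXStar]

theorem condExp_survivalEvent_payDate (hXmeas : ∀ t, Measurable (X t)) (hX : IsRCLL X)
    (hS : IsChainWithRates μ lam X S) {s₀ : Fin m} (hS₀ : ∀ᵐ ω ∂μ, S 0 ω = s₀.castSucc) (N : ℝ≥0)
    (i : ℕ) (k : Fin m) :
    μ⟦survivalEvent N S i ∩ {ω | S (payDate N i) ω = k.castSucc}|sigmaX X⟧ =ᵐ[μ]
      fun ω => survivalProd lam X N ω i s₀ k := by
  induction i generalizing k with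
  | zero =>
    have h : (survivalEvent N S 0 ∩ {ω | S (payDate N 0) ω = k.castSucc}).indicator
        (fun _ => (1 : ℝ)) =ᵐ[μ] fun _ => (1 : Matrix (Fin m) (Fin m) ℝ) s₀ k := by
      filter_upwards [hS₀] with ω hω
      by_cases hk : s₀ = k
      · subst hk
        simp [survivalEvent, payDate, hω, (Fin.castSucc_lt_last s₀).ne]
      · simp [survivalEvent, payDate, hω, hk]
    refine (condExp_congr_ae h).trans ?_
    rw [condExp_const (sigmaX_le hXmeas)]
    simp [survivalProd]
  | succ i ih =>
    rw [survivalEvent_succ_inter]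
    refine (condExp_survivalEvent_inter_of_payDate hXmeas hX hS s₀ N i ih
      (payDate_mono N i.le_succ) k.castSucc).trans (Eventually.of_forall fun ω => ?_)
    simp only [survivalProd_succ, Matrix.mul_apply, transXStar, transXStarStar,
      Matrix.submatrix_apply, id]

theorem condExp_survivalEvent_inter (hXmeas : ∀ t, Measurable (X t)) (hX : IsRCLL X)
    (hS : IsChainWithRates μ lam X S) {s₀ : Fin m} (hS₀ : ∀ᵐ ω ∂μ, S 0 ω = s₀.castSucc) (N : ℝ≥0)
    (i : ℕ) {t : ℝ≥0} (ht : payDate N i ≤ t) (l : Fin (m + 1)) :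
    μ⟦survivalEvent N S i ∩ {ω | S t ω = l}|sigmaX X⟧ =ᵐ[μ]
      fun ω => (survivalProd lam X N ω i * transXStar lam X ω (payDate N i) t) s₀ l :=
  condExp_survivalEvent_inter_of_payDate hXmeas hX hS s₀ N i
    (condExp_survivalEvent_payDate hXmeas hX hS hS₀ N i) ht l

end Chain

/-! ### Recorded and economic default times on a single path -/

section DefaultTimes

variable {m : ℕ} {Ω : Type*} {N : ℝ≥0} {S : ℝ≥0 → Ω → Fin (m + 1)} {ω : Ω}

theorem payDate_strictMono (hN : 0 < N) : StrictMono (payDate N) := fun i j h => by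
  unfold payDate
  gcongr

theorem coe_payDate_lt (hN : 0 < N) {i j : ℕ} :
    (payDate N i : ℝ≥0∞) < payDate N j ↔ i < j := by
  rw [ENNReal.coe_lt_coe, (payDate_strictMono hN).lt_iff_lt]

theorem coe_payDate_inj (hN : 0 < N) {i j : ℕ} :
    (payDate N i : ℝ≥0∞) = payDate N j ↔ i = j := by
  rw [ENNReal.coe_inj, (payDate_strictMono hN).injective.eq_iff]

theorem recordedDefault_eq_of_first {i : ℕ} (hlt : ∀ j < i, S (payDate N j) ω ≠ Fin.last m)
    (hi : S (payDate N i) ω = Fin.last m) : recordedDefault N S ω = payDate N i := by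
  refine le_antisymm (sInf_le ⟨i, rfl, hi⟩) (le_sInf ?_)
  rintro _ ⟨j, rfl, hj⟩
  exact ENNReal.coe_le_coe.2 (payDate_mono N (not_lt.1 fun h => hlt j h hj))

theorem recordedDefault_eq_top (h : ∀ j, S (payDate N j) ω ≠ Fin.last m) :
    recordedDefault N S ω = ∞ := by
  refine sInf_eq_top.2 ?_
  rintro _ ⟨j, _, hj⟩
  exact absurd hj (h j)

theorem forall_ne_or_exists_first :
    (∀ j, S (payDate N j) ω ≠ Fin.last m) ∨
      ∃ i, (∀ j < i, S (payDate N j) ω ≠ Fin.last m) ∧ S (payDate N i) ω = Fin.last m := by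
  by_cases h : ∃ i, S (payDate N i) ω = Fin.last m
  · exact Or.inr ⟨Nat.find h, fun j hj => Nat.find_min h hj, Nat.find_spec h⟩
  · exact Or.inl (not_exists.1 h)

theorem recordedDefault_eq_payDate_succ_iff (hN : 0 < N) {i : ℕ} :
    recordedDefault N S ω = payDate N (i + 1) ↔
      ω ∈ survivalEvent N S i ∩ {ω | S (payDate N (i + 1)) ω = Fin.last m} := by
  refine ⟨fun h => ?_, fun h => recordedDefault_eq_of_first
    (fun j hj => h.1 j (Nat.lt_succ_iff.1 hj)) h.2⟩
  rcases forall_ne_or_exists_first (N := N) (S := S) (ω := ω) with h' | ⟨k, hlt, hk⟩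
  · rw [recordedDefault_eq_top h'] at h
    exact absurd h ENNReal.top_ne_coe
  · rw [recordedDefault_eq_of_first hlt hk, coe_payDate_inj hN] at h
    subst h
    exact ⟨fun j hj => hlt j (Nat.lt_succ_of_le hj), hk⟩

theorem economicDefault_le_recordedDefault : economicDefault N S ω ≤ recordedDefault N S ω := by
  refine sSup_le ?_
  rintro _ ⟨t, rfl, ht, _⟩
  exact ht

theorem le_economicDefault {t : ℝ≥0} (ht : (t : ℝ≥0∞) ≤ recordedDefault N S ω)
    (h : S t ω ≠ Fin.last m) : (t : ℝ≥0∞) ≤ economicDefault N S ω :=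
  le_sSup ⟨t, rfl, ht, h⟩

/-- The inequality is strict because the chain, being right-continuous, remains for a while in the
state that it occupies at time `t`. -/
theorem lt_economicDefault (hS : ∀ t, ContinuousWithinAt (fun u => S u ω) (Set.Ici t) t) {t : ℝ≥0}
    (ht : (t : ℝ≥0∞) < recordedDefault N S ω) (h : S t ω ≠ Fin.last m) :
    (t : ℝ≥0∞) < economicDefault N S ω := by
  obtain ⟨b, htb, hb⟩ := eventually_eq_of_rightContinuous (hS t)
  obtain ⟨u, htu, hu⟩ :=
    ENNReal.lt_iff_exists_nnreal_btwn.1 (lt_min ht (ENNReal.coe_lt_coe.2 htb))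
  refine htu.trans_le (le_economicDefault (hu.le.trans (min_le_left _ _)) ?_)
  rw [hb u (ENNReal.coe_lt_coe.1 htu).le
    (ENNReal.coe_lt_coe.1 (hu.trans_le (min_le_right _ _)))]
  exact h

theorem economicDefault_eq_top (hN : 0 < N) (h : ∀ j, S (payDate N j) ω ≠ Fin.last m) :
    economicDefault N S ω = ∞ := by
  refine ENNReal.eq_top_of_forall_nnreal_le fun r => ?_
  obtain ⟨i, hi⟩ := exists_nat_ge (r / N)
  refine le_trans ?_ (le_economicDefault (t := payDate N i) ?_ (h i))
  · exact ENNReal.coe_le_coe.2 ((div_le_iff₀ hN).1 hi)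
  · rw [recordedDefault_eq_top h]
    exact le_top

/-- A default is recorded at the first payment date after the economic default. -/
theorem recordedDefault_eq_of_economicDefault_mem
    (hS : ∀ t, ContinuousWithinAt (fun u => S u ω) (Set.Ici t) t) (hN : 0 < N) {i : ℕ}
    (h : economicDefault N S ω ∈ Set.Ioc (payDate N i : ℝ≥0∞) (payDate N (i + 1))) :
    recordedDefault N S ω = payDate N (i + 1) := by
  rcases forall_ne_or_exists_first (N := N) (S := S) (ω := ω) with h' | ⟨k, hlt, hk⟩
  · rw [economicDefault_eq_top hN h'] at h
    exact absurd h.2 (by simp)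
  have hr := recordedDefault_eq_of_first hlt hk
  have hle : economicDefault N S ω ≤ payDate N k := hr ▸ economicDefault_le_recordedDefault
  obtain ⟨k, rfl⟩ : ∃ l, k = l + 1 :=
    Nat.exists_eq_succ_of_ne_zero ((coe_payDate_lt hN).1 (h.1.trans_le hle)).ne_bot
  have hgt : (payDate N k : ℝ≥0∞) < economicDefault N S ω :=
    lt_economicDefault hS (hr ▸ (coe_payDate_lt hN).2 k.lt_succ_self) (hlt k k.lt_succ_self)
  have h1 := (coe_payDate_lt hN).1 (h.1.trans_le hle)
  have h2 := (coe_payDate_lt hN).1 (hgt.trans_le h.2)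
  rw [hr, coe_payDate_inj hN]
  omega

theorem payDate_add_add_sub {t : ℝ≥0} (ht : t ≤ N) (i : ℕ) :
    payDate N i + t + (N - t) = payDate N (i + 1) := by
  rw [payDate_succ, add_assoc, add_tsub_cancel_of_le ht]

theorem payDate_succ_sub {t : ℝ≥0} (ht : t ≤ N) (i : ℕ) :
    payDate N (i + 1) - t = payDate N i + (N - t) := by
  rw [payDate_succ, add_tsub_assoc_of_le ht]

theorem economicDefault_mem_Ioc_iff
    (hS : ∀ t, ContinuousWithinAt (fun u => S u ω) (Set.Ici t) t) (hN : 0 < N) (i : ℕ)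
    {t : ℝ≥0} (ht : t ≤ N) :
    economicDefault N S ω ∈
        Set.Ioc (payDate N i : ℝ≥0∞) ((payDate N i + t : ℝ≥0) : ℝ≥0∞) ↔
      ω ∈ survivalEvent N S i ∩ defaultStay S (payDate N i + t) (N - t) := by
  have hle : payDate N i + t ≤ payDate N (i + 1) := by
    rw [payDate_succ]
    gcongr
  constructor
  · intro h
    have hr := recordedDefault_eq_of_economicDefault_mem hS hN
      (i := i) ⟨h.1, h.2.trans (ENNReal.coe_le_coe.2 hle)⟩
    have hs := (recordedDefault_eq_payDate_succ_iff hN).1 hr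
    refine ⟨hs.1, fun u hu1 hu2 => ?_⟩
    rw [payDate_add_add_sub ht] at hu2
    rcases hu2.eq_or_lt with rfl | hu2
    · exact hs.2
    · by_contra hne
      have := lt_economicDefault hS (hr ▸ ENNReal.coe_lt_coe.2 hu2) hne
      exact absurd (this.trans_le h.2) (not_lt.2 (ENNReal.coe_le_coe.2 hu1))
  · rintro ⟨hs, hstay⟩
    have hlast : S (payDate N (i + 1)) ω = Fin.last m :=
      hstay _ hle (payDate_add_add_sub ht i).ge
    have hr := (recordedDefault_eq_payDate_succ_iff (i := i) hN).2 ⟨hs, hlast⟩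
    refine ⟨lt_economicDefault hS (hr ▸ (coe_payDate_lt hN).2 i.lt_succ_self) (hs i le_rfl),
      sSup_le ?_⟩
    rintro _ ⟨u, rfl, hu, hne⟩
    rw [hr, ENNReal.coe_le_coe, ← payDate_add_add_sub ht] at hu
    exact ENNReal.coe_le_coe.2 (not_lt.1 fun hlt => hne (hstay u hlt.le hu))

theorem lag_gt_iff (hS : ∀ t, ContinuousWithinAt (fun u => S u ω) (Set.Ici t) t) (hN : 0 < N)
    {t : ℝ≥0} (ht : t ≤ N) :
    (recordedDefault N S ω ≠ ∞ ∧ (t : ℝ≥0∞) < recordedDefault N S ω - economicDefault N S ω) ↔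
      ∃ i, economicDefault N S ω ∈
        Set.Ioo (payDate N i : ℝ≥0∞) ((payDate N i + (N - t) : ℝ≥0) : ℝ≥0∞) := by
  have hsplit : ∀ i, (payDate N (i + 1) : ℝ≥0∞) =
      ((payDate N i + (N - t) : ℝ≥0) : ℝ≥0∞) + t := fun i => by
    rw [← ENNReal.coe_add, payDate_succ, add_assoc, tsub_add_cancel_of_le ht]
  simp only [lt_tsub_iff_left]
  constructor
  · rintro ⟨htop, hlt⟩
    rcases forall_ne_or_exists_first (N := N) (S := S) (ω := ω) with h' | ⟨k, hfirst, hk⟩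
    · exact absurd (recordedDefault_eq_top h') htop
    have hr := recordedDefault_eq_of_first hfirst hk
    rw [hr] at hlt
    obtain ⟨i, rfl⟩ : ∃ i, k = i + 1 := by
      refine Nat.exists_eq_succ_of_ne_zero ?_
      rintro rfl
      simp [payDate] at hlt
    refine ⟨i, lt_economicDefault hS (hr ▸ (coe_payDate_lt hN).2 i.lt_succ_self)
      (hfirst i i.lt_succ_self), ?_⟩
    rw [hsplit] at hlt
    exact (ENNReal.add_lt_add_iff_right ENNReal.coe_ne_top).1 hlt
  · rintro ⟨i, h1, h2⟩
    have hr := recordedDefault_eq_of_economicDefault_mem hS hN (i := i)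
      ⟨h1, h2.le.trans ((hsplit i).symm ▸ le_self_add)⟩
    rw [hr]
    refine ⟨ENNReal.coe_ne_top, ?_⟩
    rw [hsplit]
    exact (ENNReal.add_lt_add_iff_right ENNReal.coe_ne_top).2 h2

end DefaultTimes

/-! ### Conditional laws of the economic default time -/

section ConditionalLaws

variable {m : ℕ} {Ω : Type*} [MeasurableSpace Ω] {μ : Measure Ω}
  {lam : Fin (m + 1) → Fin (m + 1) → ℝ →ᵇ ℝ} {X : ℝ≥0 → Ω → ℝ} {S : ℝ≥0 → Ω → Fin (m + 1)}

theorem measurableSet_economicDefault_mem_Ioc (hXmeas : ∀ t, Measurable (X t))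
    (hS : IsChainWithRates μ lam X S) {N : ℝ≥0} (hN : 0 < N) (i : ℕ) {t : ℝ≥0} (ht : t ≤ N) :
    MeasurableSet {ω | economicDefault N S ω ∈
      Set.Ioc (payDate N i : ℝ≥0∞) ((payDate N i + t : ℝ≥0) : ℝ≥0∞)} := by
  simp only [economicDefault_mem_Ioc_iff (hS.rightContinuous _) hN i ht]
  refine (sup_sigmaS_le hXmeas hS _ _ (measurableSet_survivalEvent X S N i)).inter ?_
  rw [defaultStay_eq_iInter hS.rightContinuous]
  exact MeasurableSet.iInter fun n =>
    sup_sigmaS_le hXmeas hS _ _ (measurableSet_gridStay X S _ _ n (n + 1))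

variable [IsProbabilityMeasure μ]

/-- The conditional law of the state is left-continuous in time: over a short interval the
transition matrix is close to the identity. -/
theorem tendsto_condExp_inter_state (hXmeas : ∀ t, Measurable (X t)) (hX : IsRCLL X)
    (hS : IsChainWithRates μ lam X S) {a c : ℝ≥0} {s : ℕ → ℝ≥0} (has : ∀ n, a ≤ s n)
    (hsc : ∀ n, s n ≤ c) (hs : Tendsto s atTop (𝓝 c)) {E : Set Ω}
    (hE : MeasurableSet[sigmaX X ⊔ sigmaS S a] E) (j : Fin (m + 1)) :
    ∀ᵐ ω ∂μ, Tendsto (fun n => (μ⟦E ∩ {ω | S (s n) ω = j}|sigmaX X⟧) ω) atTop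
      (𝓝 ((μ⟦E ∩ {ω | S c ω = j}|sigmaX X⟧) ω)) := by
  have hmeas : ∀ n k, MeasurableSet (E ∩ {ω | S (s n) ω = k}) := fun n k =>
    (sup_sigmaS_le hXmeas hS a _ hE).inter (hS.measurable _ (MeasurableSet.singleton k))
  filter_upwards [ae_all_iff.2 fun n => condExp_inter_state_eq_sum hXmeas hX hS (hsc n)
      (sup_sigmaS_mono X S (has n) _ hE) j,
    ae_all_iff.2 fun n => ae_all_iff.2 fun k =>
      condExp_indicator_one_nonneg (μ := μ) (G := sigmaX X) (E ∩ {ω | S (s n) ω = k}),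
    ae_all_iff.2 fun n => ae_all_iff.2 fun k =>
      condExp_indicator_one_le_one (μ := μ) (sigmaX_le hXmeas) (hmeas n k)] with ω hck h0 h1
  have hlim : Tendsto (fun n => ∑ _k : Fin (m + 1),
      (Real.exp ((m + 1) * rateBound lam * (c - s n)) - 1)) atTop
      (𝓝 (∑ _k : Fin (m + 1), (Real.exp ((m + 1) * rateBound lam * (c - c)) - 1))) := by
    refine tendsto_finsetSum _ fun k _ => Tendsto.sub_const ?_ _
    refine (Real.continuous_exp.tendsto _).comp (Tendsto.const_mul _ ?_)
    exact tendsto_const_nhds.sub (NNReal.tendsto_coe.2 hs)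
  simp only [sub_self, mul_zero, Real.exp_zero, Finset.sum_const_zero] at hlim
  rw [tendsto_iff_norm_sub_tendsto_zero]
  refine squeeze_zero (fun _ => norm_nonneg _) (fun n => ?_) hlim
  have hself : (μ⟦E ∩ {ω | S (s n) ω = j}|sigmaX X⟧) ω =
      ∑ k, (μ⟦E ∩ {ω | S (s n) ω = k}|sigmaX X⟧) ω *
        (1 : Matrix (Fin (m + 1)) (Fin (m + 1)) ℝ) k j := by
    simp [Matrix.one_apply]
  rw [hck n, norm_sub_rev, hself, ← Finset.sum_sub_distrib, Real.norm_eq_abs]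
  refine (Finset.abs_sum_le_sum_abs _ _).trans (Finset.sum_le_sum fun k _ => ?_)
  rw [← mul_sub, abs_mul, abs_of_nonneg (h0 n k)]
  exact (mul_le_of_le_one_left (abs_nonneg _) (h1 n k)).trans
    (abs_transX_sub_one_le lam ω (hsc n) k j)

theorem condExp_economicDefault_mem_Ioc (hXmeas : ∀ t, Measurable (X t)) (hX : IsRCLL X)
    (hS : IsChainWithRates μ lam X S) {s₀ : Fin m} (hS₀ : ∀ᵐ ω ∂μ, S 0 ω = s₀.castSucc)
    {N : ℝ≥0} (hN : 0 < N) (i : ℕ) {t : ℝ≥0} (ht : t ≤ N) :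
    μ⟦{ω | economicDefault N S ω ∈
        Set.Ioc (payDate N i : ℝ≥0∞) ((payDate N i + t : ℝ≥0) : ℝ≥0∞)} | sigmaX X⟧
      =ᵐ[μ] fun ω =>
        (survivalProd lam X N ω i * transXStar lam X ω (payDate N i) (payDate N i + t))
            s₀ (Fin.last m) *
          Real.exp (-defaultExitIntegral lam X ω (payDate N i + t) (payDate N (i + 1))) := by
  have hset : {ω | economicDefault N S ω ∈
      Set.Ioc (payDate N i : ℝ≥0∞) ((payDate N i + t : ℝ≥0) : ℝ≥0∞)} =
      survivalEvent N S i ∩ defaultStay S (payDate N i + t) (N - t) :=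
    Set.ext fun ω => economicDefault_mem_Ioc_iff (hS.rightContinuous ω) hN i ht
  rw [hset]
  filter_upwards [condExp_inter_defaultStay hXmeas hX hS (a := payDate N i + t) (N - t)
      (sup_sigmaS_mono X S le_self_add _ (measurableSet_survivalEvent X S N i)),
    condExp_survivalEvent_inter hXmeas hX hS hS₀ N i (t := payDate N i + t) le_self_add
      (Fin.last m)] with ω h1 h2
  rw [h1, h2, payDate_add_add_sub ht]

/-- Including or excluding the right endpoint makes no difference, by left-continuity of the
conditional law of the state. -/
theorem condExp_economicDefault_mem_Ioo (hXmeas : ∀ t, Measurable (X t)) (hX : IsRCLL X)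
    (hS : IsChainWithRates μ lam X S) {s₀ : Fin m} (hS₀ : ∀ᵐ ω ∂μ, S 0 ω = s₀.castSucc)
    {N : ℝ≥0} (hN : 0 < N) (i : ℕ) {r : ℝ≥0} (hr : r ≤ N) :
    MeasurableSet {ω | economicDefault N S ω ∈
        Set.Ioo (payDate N i : ℝ≥0∞) ((payDate N i + r : ℝ≥0) : ℝ≥0∞)} ∧
    μ⟦{ω | economicDefault N S ω ∈
        Set.Ioo (payDate N i : ℝ≥0∞) ((payDate N i + r : ℝ≥0) : ℝ≥0∞)} | sigmaX X⟧
      =ᵐ[μ] fun ω =>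
        (survivalProd lam X N ω i * transXStar lam X ω (payDate N i) (payDate N i + r))
            s₀ (Fin.last m) *
          Real.exp (-defaultExitIntegral lam X ω (payDate N i + r) (payDate N (i + 1))) := by
  -- approximate `r` strictly from below
  set q : ℕ → ℝ≥0 := fun n => r * (n / (n + 1)) with hq
  have hq1 : ∀ n : ℕ, (n : ℝ≥0) / (n + 1) < 1 := fun n => by
    rw [div_lt_one (by positivity)]
    exact lt_add_one _
  have hqr : ∀ n, q n ≤ r := fun n => mul_le_of_le_one_right zero_le (hq1 n).le
  have hqlim : Tendsto q atTop (𝓝 r) := by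
    have h : Tendsto (fun n : ℕ => (n : ℝ≥0) / (n + 1)) atTop (𝓝 1) := by
      rw [← NNReal.tendsto_coe]
      push_cast
      exact tendsto_natCast_div_add_atTop 1
    simpa using h.const_mul r
  have htime : Tendsto (fun n => payDate N i + q n) atTop (𝓝 (payDate N i + r)) :=
    hqlim.const_add _
  have hmem : ∀ ω, ∀ᶠ n in atTop,
      (ω ∈ {ω | economicDefault N S ω ∈
        Set.Ioc (payDate N i : ℝ≥0∞) ((payDate N i + q n : ℝ≥0) : ℝ≥0∞)} ↔
      ω ∈ {ω | economicDefault N S ω ∈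
        Set.Ioo (payDate N i : ℝ≥0∞) ((payDate N i + r : ℝ≥0) : ℝ≥0∞)}) := by
    intro ω
    by_cases hω : economicDefault N S ω ∈
        Set.Ioo (payDate N i : ℝ≥0∞) ((payDate N i + r : ℝ≥0) : ℝ≥0∞)
    · filter_upwards [(ENNReal.tendsto_coe.2 htime).eventually_const_lt hω.2] with n hn
      exact iff_of_true ⟨hω.1, hn.le⟩ hω
    · refine Eventually.of_forall fun n => iff_of_false (fun h => hω ⟨h.1, ?_⟩) hω
      -- for `r = 0` both intervals are empty
      have hlt : q n < r := by
        rcases eq_or_ne r 0 with hr0 | hr0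
        · have := h.1.trans_le h.2
          simp [hq, hr0] at this
        · exact mul_lt_of_lt_one_right (pos_iff_ne_zero.2 hr0) (hq1 n)
      exact h.2.trans_lt (ENNReal.coe_lt_coe.2 (by gcongr))
  have hmeas := fun n => measurableSet_economicDefault_mem_Ioc hXmeas hS hN i ((hqr n).trans hr)
  refine ⟨measurableSet_of_tendsto_indicator atTop hmeas hmem,
    condExp_indicator_one_of_tendsto (sigmaX_le hXmeas) hmeas hmem
      (fun n => condExp_economicDefault_mem_Ioc hXmeas hX hS hS₀ hN i ((hqr n).trans hr)) ?_⟩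
  filter_upwards [tendsto_condExp_inter_state hXmeas hX hS (a := payDate N i)
      (fun n => le_self_add) (fun n => add_le_add_right (hqr n) _) htime
      (measurableSet_survivalEvent X S N i) (Fin.last m),
    ae_all_iff.2 fun n => condExp_survivalEvent_inter hXmeas hX hS hS₀ N i
      (t := payDate N i + q n) le_self_add (Fin.last m),
    condExp_survivalEvent_inter hXmeas hX hS hS₀ N i
      (t := payDate N i + r) le_self_add (Fin.last m)] with ω h1 h2 h3
  rw [h3] at h1
  refine (h1.congr h2).mul ((Real.continuous_exp.tendsto _).comp (Tendsto.neg ?_))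
  have hcont : Continuous fun a : ℝ => ∫ u in a..(payDate N (i + 1) : ℝ),
      exitRate lam (Fin.last m) (X u.toNNReal ω) := by
    simp only [fun a : ℝ => intervalIntegral.integral_symm (μ := volume)
      (f := fun u : ℝ => exitRate lam (Fin.last m) (X u.toNNReal ω)) (payDate N (i + 1) : ℝ) a]
    exact (intervalIntegral.continuous_primitive
      (fun a b => intervalIntegrable_exitRate_path lam hX ω a b) _).neg
  exact (hcont.tendsto _).comp (NNReal.tendsto_coe.2 htime)

end ConditionalLaws

end CommonFactorChain

open CommonFactorChain in
theorem proposition2 {m : ℕ} {Ω : Type*} [MeasurableSpace Ω] (μ : Measure Ω)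
    [IsProbabilityMeasure μ]
    (lam : Fin (m + 1) → Fin (m + 1) → ℝ →ᵇ ℝ) (hlam : ∀ i j, i ≠ j → ∀ x, 0 ≤ lam i j x)
    (X : ℝ≥0 → Ω → ℝ) (hXmeas : ∀ t, Measurable (X t)) (hX : IsRCLL X)
    (S : ℝ≥0 → Ω → Fin (m + 1)) (hS : IsChainWithRates μ lam X S)
    (s₀ : Fin m) (hS₀ : ∀ᵐ ω ∂μ, S 0 ω = s₀.castSucc)
    (N : ℝ≥0) (hN : 0 < N) :
    (∀ (i : ℕ) (t : ℝ≥0), t ≤ N →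
      μ⟦{ω | economicDefault N S ω ∈
          Set.Ioc (payDate N i : ℝ≥0∞) ((payDate N i + t : ℝ≥0) : ℝ≥0∞)} | sigmaX X⟧
        =ᵐ[μ] fun ω =>
          (survivalProd lam X N ω i * transXStar lam X ω (payDate N i) (payDate N i + t))
              s₀ (Fin.last m) *
            Real.exp (-defaultExitIntegral lam X ω (payDate N i + t) (payDate N (i + 1)))) ∧
    (∀ i : ℕ,
      μ⟦{ω | recordedDefault N S ω = (payDate N (i + 1) : ℝ≥0∞)} | sigmaX X⟧
        =ᵐ[μ] fun ω =>
          (survivalProd lam X N ω i * transXStar lam X ω (payDate N i) (payDate N (i + 1)))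
            s₀ (Fin.last m)) ∧
    (∀ t : ℝ≥0, t ≤ N →
      ∀ᵐ ω ∂μ, HasSum
        (fun i : ℕ =>
          (survivalProd lam X N ω i *
              transXStar lam X ω (payDate N i) (payDate N (i + 1) - t)) s₀ (Fin.last m) *
            Real.exp (-defaultExitIntegral lam X ω (payDate N (i + 1) - t) (payDate N (i + 1))))
        ((μ⟦{ω' | recordedDefault N S ω' ≠ ∞ ∧
            (t : ℝ≥0∞) < recordedDefault N S ω' - economicDefault N S ω'} | sigmaX X⟧) ω)) := by
  refine ⟨fun i t ht => condExp_economicDefault_mem_Ioc hXmeas hX hS hS₀ hN i ht, fun i => ?_,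
    fun t ht => ?_⟩
  · have hset : {ω | recordedDefault N S ω = (payDate N (i + 1) : ℝ≥0∞)} =
        survivalEvent N S i ∩ {ω | S (payDate N (i + 1)) ω = Fin.last m} :=
      Set.ext fun ω => recordedDefault_eq_payDate_succ_iff hN
    rw [hset]
    exact condExp_survivalEvent_inter hXmeas hX hS hS₀ N i (payDate_mono N i.le_succ) _
  · have hset : {ω' | recordedDefault N S ω' ≠ ∞ ∧
        (t : ℝ≥0∞) < recordedDefault N S ω' - economicDefault N S ω'} =
        ⋃ i : ℕ, {ω | economicDefault N S ω ∈
          Set.Ioo (payDate N i : ℝ≥0∞) ((payDate N i + (N - t) : ℝ≥0) : ℝ≥0∞)} := by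
      ext ω
      rw [Set.mem_iUnion]
      exact lag_gt_iff (hS.rightContinuous ω) hN ht
    have hIoo := fun i : ℕ =>
      condExp_economicDefault_mem_Ioo hXmeas hX hS hS₀ hN i (r := N - t) tsub_le_self
    have hrec : ∀ (i : ℕ) (ω : Ω), economicDefault N S ω ∈
        Set.Ioo (payDate N i : ℝ≥0∞) ((payDate N i + (N - t) : ℝ≥0) : ℝ≥0∞) →
        recordedDefault N S ω = payDate N (i + 1) := fun i ω h =>
      recordedDefault_eq_of_economicDefault_mem (hS.rightContinuous ω) hN
        ⟨h.1, h.2.le.trans (ENNReal.coe_le_coe.2 (by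
          rw [payDate_succ]
          exact add_le_add_right tsub_le_self _))⟩
    rw [hset]
    have hdisj : Pairwise (Function.onFun Disjoint fun i : ℕ => {ω | economicDefault N S ω ∈
        Set.Ioo (payDate N i : ℝ≥0∞) ((payDate N i + (N - t) : ℝ≥0) : ℝ≥0∞)}) :=
      fun i j hij => Set.disjoint_left.2 fun ω hi hj => hij <| Nat.succ_injective <|
        (coe_payDate_inj hN).1 ((hrec i ω hi).symm.trans (hrec j ω hj))
    filter_upwards [hasSum_condExp_indicator_one (μ := μ) (sigmaX_le hXmeas)
      (fun i => (hIoo i).1) hdisj, ae_all_iff.2 fun i => (hIoo i).2] with ω h1 h2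
    simpa only [h2, payDate_succ_sub ht] using h1
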